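/- Let $\mathbf K$ be either the skew field of quaternions $\mathbf H$ ($r=2$) or the algebra of octonions $\mathbf O$ ($r=3$), with standard generators $i_0=1,i_1,\dots,i_{2^r-1}$, conjugation $z\mapsto\tilde z$, $\mathrm{Re}(z)=(z+\tilde z)/2$ and Euclidean norm $|z|^2=z\tilde z$; let $n\ge 1$ and $|z|^2=\sum_j|{}_jz|^2$ for $z=({}_1z,\dots,{}_nz)\in\mathbf K^n$. **Definitions.** A function $f$ is *$\mathbf K$-holomorphic* on an open set $U\subseteq\mathbf K^n$ if near each $\xi\in U$ it is the sum of a convergent power series $f(z)=\sum_{c\ge 0}\phi_c(z-\xi)$, where each $\phi_c$ is homogeneous of degree $c$ and is a finite sum of (bracketed) products of constants from $\mathbf K$ and of the variables ${}_1z,\dots,{}_nz$ (their conjugates do not occur). A function $g$ of one variable $z\in\mathbf K$ is *pseudoconformal at* $\xi$ if it is $\mathbf K$-holomorphic at $\xi$ (so that $\partial g/\partial\tilde z=0$) and its derivative $A=g'(\xi)$ is nonzero, satisfies $$\mathrm{Re}\{(Ah_1)(Ah_2)^{*}\}\,|h_1|\,|h_2|=|Ah_1|\,|Ah_2|\,\mathrm{Re}(h_1\tilde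 h_2)\qquad(h_1,h_2\in\mathbf K),$$ and is not associated with a nonproper rotation of the underlying real space, i.e. $\det_{\mathbf R}A>0$. For a set $V$ put $$\rho_V(f,g)=\sup_{z\in V}\Big[\,|f(z)-g(z)|+\sup_{h\in\mathbf K^n,\ |h|=1}|f'(z).h-g'(z).h|\,\Big].$$ A family $\mathcal F$ of functions with values in $\mathbf K$ on an open set $U\subseteq\mathbf K^n$ is *normal* if each $f\in\mathcal F$ is $\mathbf K$-holomorphic on $U$ and, at each point of $U$ and for each $j$, is either pseudoconformal in the variable ${}_jz$ or has $\partial f/\partial\,{}_jz=0$, and if for each sequence $(f_m)$ in $\mathcal F$ and each closed bounded $V\subseteq U$ with $\mathrm{cl}(\mathrm{Int}\,V)=V$ there is a subsequence that converges with respect to $\rho_V$ either to a finite limit function (of class $C^1$ in a neighbourhood of $V$) or to the constant $\infty$; the latter means that the members $f_{m_k}$ eventually have no zeros on $V$ and $\rho_V(1/f_{m_k},0)\to0$. **Theorem.** Let $U\subseteq\mathbf K^n$ be an open set such that for each $j=1,\dots,n$ the projection $U_j=p_j(U)\subseteq\mathbf K$ to the $j$-th coordinate is $(2^r-1)$-connected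 (it is path connected and $\pi_k(U_j,x)$ is trivial for each base point $x$ and $1\le k\le 2^r-1$), and such that for each $k=0,\dots,2^{r-1}-1$, with $s=i_{2k}$ and $p=i_{2k+1}$, and each $t$ in the real span of the generators other than $s,p$, the section $\{u\in\mathbf Rs+\mathbf Rp:\ u+t\in U_j\}$ is simply connected whenever it is nonempty. Let $\mathcal F$ be a family of $\mathbf K$-valued $\mathbf K$-holomorphic functions on $U$ such that each $f\in\mathcal F$, at each point of $U$ and for each $j$, is either pseudoconformal in the variable ${}_jz$ or has $\partial f/\partial\,{}_jz=0$. If $\mathcal F$ is uniformly bounded, $$\sup_{z\in U,\ f\in\mathcal F}|f(z)|<\infty,$$ then $\mathcal F$ is a normal family on $U$. -/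

import Mathlib

/-- The octonions, obtained from the quaternions by the doubling procedure: a pair `(a, b)` stands
for `a + b l`, and the norm is the Euclidean one, `|a + b l| ^ 2 = |a| ^ 2 + |b| ^ 2`. -/
def Octonion : Type := WithLp 2 (Quaternion ℝ × Quaternion ℝ)

namespace Octonion

noncomputable instance : NormedAddCommGroup Octonion :=
  inferInstanceAs (NormedAddCommGroup (WithLp 2 (Quaternion ℝ × Quaternion ℝ)))

noncomputable instance : InnerProductSpace ℝ Octonion :=
  inferInstanceAs (InnerProductSpace ℝ (WithLp 2 (Quaternion ℝ × Quaternion ℝ)))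

instance : FiniteDimensional ℝ Octonion :=
  inferInstanceAs (FiniteDimensional ℝ (WithLp 2 (Quaternion ℝ × Quaternion ℝ)))

/-- The octonion `a + b l`. -/
def mk (a b : Quaternion ℝ) : Octonion := WithLp.toLp 2 (a, b)

/-- The component `a` of `a + b l`. -/
def fst (z : Octonion) : Quaternion ℝ := (WithLp.ofLp z).1

/-- The component `b` of `a + b l`. -/
def snd (z : Octonion) : Quaternion ℝ := (WithLp.ofLp z).2

noncomputable instance : One Octonion := ⟨mk 1 0⟩

/-- `(a + b l) (c + d l) = (a c - d̃ b) + (d a + b c̃) l`. -/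
noncomputable instance : Mul Octonion :=
  ⟨fun z w => mk (z.fst * w.fst - star w.snd * z.snd) (w.snd * z.fst + z.snd * star w.fst)⟩

/-- `(a + b l)~ = ã - b l`. -/
noncomputable instance : Star Octonion := ⟨fun z => mk (star z.fst) (-z.snd)⟩

theorem norm_sq_eq (z : Octonion) : ‖z‖ ^ 2 = ‖z.fst‖ ^ 2 + ‖z.snd‖ ^ 2 :=
  WithLp.prod_norm_sq_eq_of_L2 (x := (z : WithLp 2 (Quaternion ℝ × Quaternion ℝ)))

/-- `z z̃ = |z| ^ 2`. -/
theorem mul_star_self (z : Octonion) : z * star z = (‖z‖ ^ 2) • (1 : Octonion) := by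
  rw [norm_sq_eq]
  change mk (z.fst * star z.fst - star (-z.snd) * z.snd)
      (-z.snd * z.fst + z.snd * star (star z.fst)) =
    mk ((‖z.fst‖ ^ 2 + ‖z.snd‖ ^ 2) • (1 : Quaternion ℝ))
      ((‖z.fst‖ ^ 2 + ‖z.snd‖ ^ 2) • (0 : Quaternion ℝ))
  have h : ∀ a : Quaternion ℝ, ((‖a‖ ^ 2 : ℝ) : Quaternion ℝ) = (‖a‖ ^ 2) • 1 := by
    intro a
    rw [← Quaternion.coe_mul_eq_smul, mul_one]
  congr 1
  · rw [star_neg, Quaternion.self_mul_star, neg_mul, Quaternion.star_mul_self,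
      Quaternion.normSq_eq_norm_mul_self, Quaternion.normSq_eq_norm_mul_self, ← sq, ← sq, h, h,
      add_smul, sub_neg_eq_add]
  · simp

end Octonion

/-- The standard generators `i_0 = 1, i_1, i_2, i_3` of the quaternions. -/
noncomputable def quaternionGen : Fin (2 ^ 2) → Quaternion ℝ :=
  ![⟨1, 0, 0, 0⟩, ⟨0, 1, 0, 0⟩, ⟨0, 0, 1, 0⟩, ⟨0, 0, 0, 1⟩]

/-- The standard generators `i_0 = 1, …, i_7` of the octonions: `i_4 = l` and
`i_{4 + k} = i_k l` for `k = 1, 2, 3`. -/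
noncomputable def octonionGen : Fin (2 ^ 3) → Octonion :=
  ![.mk ⟨1, 0, 0, 0⟩ 0, .mk ⟨0, 1, 0, 0⟩ 0, .mk ⟨0, 0, 1, 0⟩ 0, .mk ⟨0, 0, 0, 1⟩ 0,
    .mk 0 ⟨1, 0, 0, 0⟩, .mk 0 ⟨0, 1, 0, 0⟩, .mk 0 ⟨0, 0, 1, 0⟩, .mk 0 ⟨0, 0, 0, 1⟩]

/-! The notions below are written once for an algebra `K`; they are only used for the quaternions
and the octonions. -/

/-- The space `K ^ n` with the norm `|z| ^ 2 = ∑ j, |z_j| ^ 2`. -/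
abbrev KSpace (K : Type) (n : ℕ) : Type := PiLp 2 (fun _ : Fin n => K)

/-- The words of degree `c` in the variables `x i`, `i : ι`, as functions on `E`: bracketed products,
in any order and with any arrangement of the brackets, of constants from `K` and of exactly `c`
factors that are variables. The conjugates of the variables are not among the symbols. -/
inductive IsWord {K E ι : Type} [Mul K] (x : ι → E → K) : ℕ → (E → K) → Prop
  | const (a : K) : IsWord x 0 (fun _ => a)
  | var (i : ι) : IsWord x 1 (x i)
  | mul {c d : ℕ} {u v : E → K} (hu : IsWord x c u) (hv : IsWord x d v) :
      IsWord x (c + d) (fun z => u z * v z)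

/-- A function is homogeneous polynomial of degree `c` if it is a finite sum of words of
degree `c`. -/
def IsHomogeneousPhrase {K E ι : Type} [Mul K] [AddCommMonoid K]
    (x : ι → E → K) (c : ℕ) (φ : E → K) : Prop :=
  φ ∈ AddSubmonoid.closure {w : E → K | IsWord x c w}

/-- `f` is `K`-holomorphic at `ξ` with respect to the variables `x`: near `ξ` it is the sum of a
convergent power series `f z = ∑ c, φ_c (z - ξ)` whose homogeneous terms `φ_c` are finite sums of
words in the variables `x i` (and not in their conjugates) with constants from `K`. -/
def KHolomorphicAt {K E ι : Type} [Mul K] [NormedAddCommGroup K] [NormedSpace ℝ K]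
    [NormedAddCommGroup E] [NormedSpace ℝ E] (x : ι → E → K) (f : E → K) (ξ : E) : Prop :=
  ∃ p : FormalMultilinearSeries ℝ E K, HasFPowerSeriesAt f p ξ ∧
    ∀ c : ℕ, IsHomogeneousPhrase x c (fun z => p c (fun _ => z))

/-- `f` is `K`-holomorphic on `U ⊆ K ^ n`. -/
def KHolomorphicOn {K : Type} [Mul K] [NormedAddCommGroup K] [NormedSpace ℝ K] {n : ℕ}
    (f : KSpace K n → K) (U : Set (KSpace K n)) : Prop :=
  ∀ ξ ∈ U, KHolomorphicAt (fun (j : Fin n) (z : KSpace K n) => z j) f ξ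

/-- `Re z = (z + z̃) / 2`, as an element of `ℝ ⊆ K`. -/
noncomputable def kRe {K : Type} [AddCommGroup K] [Module ℝ K] [Star K] (z : K) : K :=
  (1 / 2 : ℝ) • (z + star z)

/-- A function `g` of one variable in `K` is pseudoconformal at `ξ`: it is holomorphic in the
variable `z` at `ξ`, without `z̃` (so `∂g/∂z̃ = 0`), and its derivative `A = g'(ξ)` is nonzero,
satisfies `Re {(A h₁) (A h₂)~} |h₁| |h₂| = |A h₁| |A h₂| Re (h₁ h̃₂)` for all `h₁, h₂`, and is not
associated with a nonproper rotation of the underlying real space. -/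
def PseudoconformalAt {K : Type} [Mul K] [Star K] [NormedAddCommGroup K] [NormedSpace ℝ K]
    (g : K → K) (ξ : K) : Prop :=
  KHolomorphicAt (fun (_ : Unit) (z : K) => z) g ξ ∧
  (∀ h₁ h₂ : K,
    (‖h₁‖ * ‖h₂‖) • kRe (fderiv ℝ g ξ h₁ * star (fderiv ℝ g ξ h₂)) =
      (‖fderiv ℝ g ξ h₁‖ * ‖fderiv ℝ g ξ h₂‖) • kRe (h₁ * star h₂)) ∧
  fderiv ℝ g ξ ≠ 0 ∧
  0 < LinearMap.det (fderiv ℝ g ξ : K →ₗ[ℝ] K)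

/-- The function `w ↦ f (ξ_1, …, w, …, ξ_n)` of the `j`-th variable. -/
def partialFun {K : Type} {n : ℕ} (f : KSpace K n → K) (ξ : KSpace K n) (j : Fin n) : K → K :=
  fun w => f (WithLp.toLp 2 (Function.update (WithLp.ofLp ξ) j w))

/-- At each point of `U`, by each variable, `f` is either pseudoconformal or has zero partial
derivative. -/
def PseudoconformalOrZeroOn {K : Type} [Mul K] [Star K] [NormedAddCommGroup K] [NormedSpace ℝ K]
    {n : ℕ} (f : KSpace K n → K) (U : Set (KSpace K n)) : Prop :=
  ∀ ξ ∈ U, ∀ j : Fin n,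
    PseudoconformalAt (partialFun f ξ j) (ξ j) ∨ fderiv ℝ (partialFun f ξ j) (ξ j) = 0

/-- The `C¹` metric
`ρ_V (f, g) = sup_{z ∈ V} [|f z - g z| + sup_{|h| = 1} |f'(z) h - g'(z) h|]`. -/
noncomputable def rhoDist {K E : Type} [NormedAddCommGroup K] [NormedSpace ℝ K]
    [NormedAddCommGroup E] [NormedSpace ℝ E] (V : Set E) (f g : E → K) : ENNReal :=
  ⨆ z ∈ V, (‖f z - g z‖ₑ + ⨆ (h : E) (_ : ‖h‖ = 1), ‖fderiv ℝ f z h - fderiv ℝ g z h‖ₑ)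

/-- The inverse `1 / w = |w|⁻² w̃`, the chart at infinity of the one-point compactification
of `K`. -/
noncomputable def kInv {K : Type} [Star K] [NormedAddCommGroup K] [NormedSpace ℝ K] (w : K) : K :=
  (‖w‖ ^ 2)⁻¹ • star w

/-- A sequence converges with respect to `ρ_V` to a finite limit function; the limit is `C¹` in a
neighbourhood of `V`, so that its derivative makes sense at all points of `V`. -/
def RhoTendstoFinite {K : Type} [NormedAddCommGroup K] [NormedSpace ℝ K] {n : ℕ}
    (V : Set (KSpace K n)) (f : ℕ → KSpace K n → K) : Prop :=
  ∃ (g : KSpace K n → K) (W : Set (KSpace K n)), IsOpen W ∧ V ⊆ W ∧ ContDiffOn ℝ 1 g W ∧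
    Filter.Tendsto (fun k => rhoDist V (f k) g) Filter.atTop (nhds 0)

/-- A sequence converges with respect to `ρ_V` to the constant `∞`, in the chart at infinity. -/
def RhoTendstoInfinity {K : Type} [Star K] [NormedAddCommGroup K] [NormedSpace ℝ K] {n : ℕ}
    (V : Set (KSpace K n)) (f : ℕ → KSpace K n → K) : Prop :=
  (∀ᶠ k in Filter.atTop, ∀ z ∈ V, f k z ≠ 0) ∧
    Filter.Tendsto (fun k => rhoDist V (fun z => kInv (f k z)) (fun _ => 0))
      Filter.atTop (nhds 0)

/-- Normal families on an open set `U ⊆ K ^ n`. The sets `V` are the canonical closed bounded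
subsets of `U`. -/
def IsNormalFamily {K : Type} [Mul K] [Star K] [NormedAddCommGroup K] [NormedSpace ℝ K] {n : ℕ}
    (U : Set (KSpace K n)) (F : Set (KSpace K n → K)) : Prop :=
  (∀ f ∈ F, KHolomorphicOn f U ∧ PseudoconformalOrZeroOn f U) ∧
  ∀ f : ℕ → KSpace K n → K, (∀ m, f m ∈ F) →
    ∀ V : Set (KSpace K n), V ⊆ U → Bornology.IsBounded V → closure (interior V) = V →
      IsClosed V →
      ∃ φ : ℕ → ℕ, StrictMono φ ∧
        (RhoTendstoFinite V (fun k => f (φ k)) ∨ RhoTendstoInfinity V (fun k => f (φ k)))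

/-- A subset is `m`-connected: it is path connected and its homotopy groups `π_k`, `1 ≤ k ≤ m`, are
trivial at each base point. -/
def IsMConnected {X : Type} [TopologicalSpace X] (m : ℕ) (S : Set X) : Prop :=
  IsPathConnected S ∧
    ∀ k : ℕ, 1 ≤ k → k ≤ m → ∀ x : S, Subsingleton (HomotopyGroup.Pi k S x)

/-- `π_{s,p,t}(S)`: the set of all `u` in the real span of `s = e a` and `p = e b` with
`u + t ∈ S`. -/
def planeSection {K ι : Type} [AddCommGroup K] [Module ℝ K] (e : ι → K) (a b : ι) (t : K)
    (S : Set K) : Set K :=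
  {u | u ∈ Submodule.span ℝ {e a, e b} ∧ u + t ∈ S}

/-- The topological conditions on `U ⊆ K ^ n`, where `e = (i_0, …, i_{2 ^ r - 1})` are the standard
generators: each projection `U_j = p_j(U)` is `(2 ^ r - 1)`-connected, and for `s = i_{2k}`,
`p = i_{2k+1}` and each `t` in the span of the other generators every nonempty section
`π_{s,p,t}(U_j)` is simply connected. -/
def ProjectionConditions {K : Type} [NormedAddCommGroup K] [NormedSpace ℝ K] {r n : ℕ}
    (e : Fin (2 ^ r) → K) (U : Set (KSpace K n)) : Prop :=
  ∀ j : Fin n,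
    IsMConnected (2 ^ r - 1) ((fun z : KSpace K n => z j) '' U) ∧
    ∀ a b : Fin (2 ^ r), (∃ k : ℕ, (a : ℕ) = 2 * k ∧ (b : ℕ) = 2 * k + 1) →
      ∀ t ∈ Submodule.span ℝ (e '' {v | v ≠ a ∧ v ≠ b}),
        (planeSection e a b t ((fun z : KSpace K n => z j) '' U)).Nonempty →
          SimplyConnectedSpace (planeSection e a b t ((fun z : KSpace K n => z j) '' U))

/-!
The idea is Liouville's theorem on conformal maps, in a quantitative form. Quaternions and octonions
have real dimension `4` and `8`, hence at least `3`, and there a conformal map is so rigid that a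
bound for the map gives bounds for its first and second derivatives.

Let `g` be a smooth map of a ball whose derivative at each point preserves orthogonality, that is,
is a similarity or zero. Where `g' ≠ 0`, let `1 / ρ` be the scaling factor of `g'`. The Koszul
formula expresses the second derivatives of `g` through its first derivatives and those of `ρ`, and
it shows that for orthogonal `u`, `v` the mixed derivative of `ρ g` is `(ρ g)_uv = ρ_uv g`.
Comparing third derivatives in three orthogonal directions gives `ρ_uv = 0`
(`IsConformalWith.dirDeriv_dirDeriv_recip_of_inner_eq_zero`; this is where dimension three is
needed). So `ρ` is a quadratic polynomial with Hessian `α • id`, and a further differentiation gives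
`|∇ρ| ^ 2 = 2 α ρ` (`IsConformalWith.exists_gradient`). In particular `ρ` is bounded, so `g` has no
critical points unless it is constant (`isConformalWith_of_exists_ne_zero`). On a ball of radius `R`
about `a` the zero of the polynomial `ρ` lies outside the ball, whence `|∇ρ(a)| ≤ 2 ρ(a) / R`. This
controls the second derivatives by the scaling factor, and then `|g| ≤ c` bounds the scaling factor
by a multiple of `c / R` (`norm_fderiv_le_of_conformal`).

A function of the family satisfies these estimates in each variable separately. Hence the family is
locally equi-Lipschitz, and by the Arzelà–Ascoli theorem every sequence has a subsequence that
converges uniformly near the given compact set. The bounds on the second derivatives in each variable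
let the first derivatives be recovered from nearby values of the function
(`IsSeparatelyConformalOn.norm_fderiv_sub_fderiv_le`), so the derivatives converge uniformly as well,
and the limit is finite and of class `C¹`.
-/

open scoped ContDiff RealInnerProductSpace

/-! ### Linear algebra -/

/-- A symmetric bilinear form that vanishes on orthogonal pairs is a multiple of the inner
product: for `‖u‖ = ‖v‖` the vectors `u + v` and `u - v` are orthogonal, so the form has the same
value at `(u, u)` and `(v, v)`. -/
theorem bilin_eq_inner_mul_of_orthogonal {E : Type*} [NormedAddCommGroup E]
    [InnerProductSpace ℝ E] (β : E →ₗ[ℝ] E →ₗ[ℝ] ℝ) (hsymm : ∀ u v, β u v = β v u)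
    (horth : ∀ u v, ⟪u, v⟫ = 0 → β u v = 0) {e : E} (he : ‖e‖ = 1) (u v : E) :
    β u v = ⟪u, v⟫ * β e e := by
  have hdiag : ∀ u : E, β u u = ‖u‖ ^ 2 * β e e := by
    intro u
    have h := horth (u + ‖u‖ • e) (u - ‖u‖ • e) (by
      rw [inner_add_left, inner_sub_right, inner_sub_right, real_inner_comm u (‖u‖ • e),
        real_inner_self_eq_norm_sq, real_inner_self_eq_norm_sq, norm_smul, he]
      simp)
    simp only [map_add, map_sub, map_smul, LinearMap.add_apply, LinearMap.smul_apply,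
      smul_eq_mul, hsymm e u] at h
    linarith
  have h := hdiag (u + v)
  rw [norm_add_sq_real] at h
  simp only [map_add, LinearMap.add_apply, hdiag u, hdiag v, hsymm v u] at h
  linarith

theorem exists_norm_eq_one_orthogonal {E : Type*} [NormedAddCommGroup E]
    [InnerProductSpace ℝ E] [FiniteDimensional ℝ E] (hd : 3 ≤ Module.finrank ℝ E) (u v : E) :
    ∃ w : E, ‖w‖ = 1 ∧ ⟪u, w⟫ = 0 ∧ ⟪v, w⟫ = 0 := by
  have hspan : Module.finrank ℝ (Submodule.span ℝ {u, v}) ≤ 2 := by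
    classical
    have h := finrank_span_finset_le_card (R := ℝ) ({u, v} : Finset E)
    rw [Finset.coe_pair] at h
    exact h.trans Finset.card_le_two
  have hsum := Submodule.finrank_add_finrank_orthogonal (Submodule.span ℝ {u, v})
  have hpos : 0 < Module.finrank ℝ (Submodule.span ℝ {u, v})ᗮ := by omega
  have : Nontrivial (Submodule.span ℝ {u, v})ᗮ := Module.finrank_pos_iff.1 hpos
  obtain ⟨w, hw⟩ := exists_norm_eq ((Submodule.span ℝ {u, v})ᗮ) zero_le_one
  refine ⟨w, hw, ?_, ?_⟩
  · exact (Submodule.mem_orthogonal _ _).1 w.2 u (Submodule.subset_span (by simp))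
  · exact (Submodule.mem_orthogonal _ _).1 w.2 v (Submodule.subset_span (by simp))

/-! ### Directional derivatives -/

section DirDeriv

variable {E G : Type*} [NormedAddCommGroup E] [NormedSpace ℝ E] [NormedAddCommGroup G]
  [NormedSpace ℝ G]

/-- The derivative of `F` in the fixed direction `u`, as a function of the point. -/
noncomputable def dirDeriv (u : E) (F : E → G) : E → G := fun x => fderiv ℝ F x u

theorem ContDiffOn.dirDeriv {Ω : Set E} {F : E → G} (hF : ContDiffOn ℝ ∞ F Ω) (hΩ : IsOpen Ω)
    (u : E) : ContDiffOn ℝ ∞ (dirDeriv u F) Ω :=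
  (hF.fderiv_of_isOpen hΩ (m := ∞) (by simp)).clm_apply contDiffOn_const

theorem ContDiffOn.differentiableAt_of_isOpen {Ω : Set E} {F : E → G}
    (hF : ContDiffOn ℝ ∞ F Ω) (hΩ : IsOpen Ω) {x : E} (hx : x ∈ Ω) : DifferentiableAt ℝ F x :=
  (hF.contDiffAt (hΩ.mem_nhds hx)).differentiableAt (by simp)

theorem dirDeriv_dirDeriv {Ω : Set E} {F : E → G} (hF : ContDiffOn ℝ ∞ F Ω) (hΩ : IsOpen Ω)
    (u v : E) {x : E} (hx : x ∈ Ω) :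
    dirDeriv u (dirDeriv v F) x = fderiv ℝ (fderiv ℝ F) x u v := by
  have hd : DifferentiableAt ℝ (fderiv ℝ F) x :=
    ((hF.fderiv_of_isOpen hΩ (m := ∞) (by simp)).contDiffAt
      (hΩ.mem_nhds hx)).differentiableAt (by simp)
  change fderiv ℝ (fun y => fderiv ℝ F y v) x u = _
  rw [fderiv_clm_apply hd (differentiableAt_const v)]
  simp

theorem dirDeriv_comm {Ω : Set E} {F : E → G} (hF : ContDiffOn ℝ ∞ F Ω) (hΩ : IsOpen Ω)
    (u v : E) {x : E} (hx : x ∈ Ω) :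
    dirDeriv u (dirDeriv v F) x = dirDeriv v (dirDeriv u F) x := by
  rw [dirDeriv_dirDeriv hF hΩ u v hx, dirDeriv_dirDeriv hF hΩ v u hx]
  exact (hF.contDiffAt (hΩ.mem_nhds hx)).isSymmSndFDerivAt
    (by rw [minSmoothness_of_isRCLikeNormedField]; exact WithTop.coe_le_coe.2 le_top) u v

theorem dirDeriv_congr {Ω : Set E} {F₁ F₂ : E → G} (hΩ : IsOpen Ω)
    (h : ∀ x ∈ Ω, F₁ x = F₂ x) (u : E) {x : E} (hx : x ∈ Ω) :
    dirDeriv u F₁ x = dirDeriv u F₂ x := by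
  have : F₁ =ᶠ[nhds x] F₂ := Filter.eventuallyEq_of_mem (hΩ.mem_nhds hx) h
  simp only [dirDeriv, this.fderiv_eq]

theorem dirDeriv_swap {Ω : Set E} {F : E → G} (hF : ContDiffOn ℝ ∞ F Ω) (hΩ : IsOpen Ω)
    (u v w : E) {x : E} (hx : x ∈ Ω) :
    dirDeriv w (dirDeriv u (dirDeriv v F)) x = dirDeriv v (dirDeriv u (dirDeriv w F)) x := by
  rw [dirDeriv_comm (hF.dirDeriv hΩ v) hΩ w u hx,
    dirDeriv_congr hΩ (fun y hy => dirDeriv_comm hF hΩ w v hy) u hx,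
    dirDeriv_comm (hF.dirDeriv hΩ w) hΩ u v hx]

theorem dirDeriv_eq_zero_of_const {Ω : Set E} {F : E → G} (hΩ : IsOpen Ω) (c : G)
    (h : ∀ x ∈ Ω, F x = c) (u : E) {x : E} (hx : x ∈ Ω) : dirDeriv u F x = 0 := by
  rw [dirDeriv_congr hΩ (F₂ := fun _ => c) h u hx]
  simp [dirDeriv]

theorem dirDeriv_smul {r : E → ℝ} {F : E → G} {x : E} (hr : DifferentiableAt ℝ r x)
    (hF : DifferentiableAt ℝ F x) (u : E) :
    dirDeriv u (fun y => r y • F y) x = r x • dirDeriv u F x + dirDeriv u r x • F x := by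
  simp only [dirDeriv]
  rw [fderiv_fun_smul hr hF]
  simp

theorem dirDeriv_mul {r F : E → ℝ} {x : E} (hr : DifferentiableAt ℝ r x)
    (hF : DifferentiableAt ℝ F x) (u : E) :
    dirDeriv u (fun y => r y * F y) x = r x * dirDeriv u F x + dirDeriv u r x * F x :=
  dirDeriv_smul hr hF u

theorem dirDeriv_add {F₁ F₂ : E → G} {x : E} (h₁ : DifferentiableAt ℝ F₁ x)
    (h₂ : DifferentiableAt ℝ F₂ x) (u : E) :
    dirDeriv u (fun y => F₁ y + F₂ y) x = dirDeriv u F₁ x + dirDeriv u F₂ x := by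
  simp only [dirDeriv]
  rw [fderiv_fun_add h₁ h₂]
  simp

theorem dirDeriv_sub {F₁ F₂ : E → G} {x : E} (h₁ : DifferentiableAt ℝ F₁ x)
    (h₂ : DifferentiableAt ℝ F₂ x) (u : E) :
    dirDeriv u (fun y => F₁ y - F₂ y) x = dirDeriv u F₁ x - dirDeriv u F₂ x := by
  simp only [dirDeriv]
  rw [fderiv_fun_sub h₁ h₂]
  simp

theorem dirDeriv_inner {H : Type*} [NormedAddCommGroup H] [InnerProductSpace ℝ H]
    {F₁ F₂ : E → H} {x : E} (h₁ : DifferentiableAt ℝ F₁ x)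
    (h₂ : DifferentiableAt ℝ F₂ x) (u : E) :
    dirDeriv u (fun y => ⟪F₁ y, F₂ y⟫) x = ⟪F₁ x, dirDeriv u F₂ x⟫ + ⟪dirDeriv u F₁ x, F₂ x⟫ := by
  simp only [dirDeriv]
  rw [fderiv_inner_apply ℝ h₁ h₂]

theorem eq_of_dirDeriv_eq_zero {Ω : Set E} {F : E → G} (hΩ : IsOpen Ω)
    (hc : IsPreconnected Ω) (hF : DifferentiableOn ℝ F Ω)
    (h : ∀ x ∈ Ω, ∀ u, dirDeriv u F x = 0) {x y : E} (hx : x ∈ Ω) (hy : y ∈ Ω) : F x = F y :=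
  hΩ.is_const_of_fderiv_eq_zero hc hF (fun z hz => ContinuousLinearMap.ext (h z hz)) hx hy

theorem dirDeriv_dirDeriv_smul {Ω : Set E} {r : E → ℝ} {F : E → G} (hΩ : IsOpen Ω)
    (hr : ContDiffOn ℝ ∞ r Ω) (hF : ContDiffOn ℝ ∞ F Ω) (u v : E) {x : E} (hx : x ∈ Ω) :
    dirDeriv u (dirDeriv v (fun y => r y • F y)) x =
      dirDeriv u (dirDeriv v r) x • F x + dirDeriv v r x • dirDeriv u F x +
        dirDeriv u r x • dirDeriv v F x + r x • dirDeriv u (dirDeriv v F) x := by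
  have hr' := fun y (hy : y ∈ Ω) => hr.differentiableAt_of_isOpen hΩ hy
  have hF' := fun y (hy : y ∈ Ω) => hF.differentiableAt_of_isOpen hΩ hy
  have hrv := (hr.dirDeriv hΩ v).differentiableAt_of_isOpen hΩ hx
  have hFv := (hF.dirDeriv hΩ v).differentiableAt_of_isOpen hΩ hx
  rw [dirDeriv_congr hΩ (fun y hy => dirDeriv_smul (hr' y hy) (hF' y hy) v) u hx,
    dirDeriv_add ((hr' x hx).fun_smul hFv) (hrv.fun_smul (hF' x hx)),
    dirDeriv_smul (hr' x hx) hFv, dirDeriv_smul hrv (hF' x hx)]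
  abel

end DirDeriv

/-! ### Liouville's theorem on conformal maps -/

section Liouville

variable {E : Type*} [NormedAddCommGroup E] [InnerProductSpace ℝ E]

theorem inner_dirDeriv_eq_of_orthogonal {g : E → E} {x : E}
    (hconf : ∀ u v : E, ⟪u, v⟫ = 0 → ⟪dirDeriv u g x, dirDeriv v g x⟫ = 0)
    {e : E} (he : ‖e‖ = 1) (u v : E) :
    ⟪dirDeriv u g x, dirDeriv v g x⟫ = ‖dirDeriv e g x‖ ^ 2 * ⟪u, v⟫ := by
  let β : E →ₗ[ℝ] E →ₗ[ℝ] ℝ := LinearMap.mk₂ ℝ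
    (fun a b => ⟪fderiv ℝ g x a, fderiv ℝ g x b⟫)
    (by intros; simp [inner_add_left]) (by intros; simp [inner_smul_left])
    (by intros; simp [inner_add_right]) (by intros; simp [inner_smul_right])
  have h := bilin_eq_inner_mul_of_orthogonal β
    (fun a b => real_inner_comm _ _) (fun a b hab => hconf a b hab) he u v
  simp only [β, LinearMap.mk₂_apply, real_inner_self_eq_norm_sq] at h
  rw [mul_comm]
  exact h

/-- `g` is a smooth conformal map on the open set `Ω`, and the positive smooth function `ρ` is the
reciprocal of its scaling factor: `ρ x • g'(x)` is an isometry. -/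
structure IsConformalWith (g : E → E) (ρ : E → ℝ) (Ω : Set E) : Prop where
  isOpen : IsOpen Ω
  contDiffOn : ContDiffOn ℝ ∞ g Ω
  contDiffOn_recip : ContDiffOn ℝ ∞ ρ Ω
  pos : ∀ x ∈ Ω, 0 < ρ x
  inner_eq : ∀ x ∈ Ω, ∀ u v, ρ x ^ 2 * ⟪dirDeriv u g x, dirDeriv v g x⟫ = ⟪u, v⟫

namespace IsConformalWith

variable {g : E → E} {ρ : E → ℝ} {Ω : Set E} {x : E}

theorem mono {Ω' : Set E} (h : IsConformalWith g ρ Ω) (hΩ' : IsOpen Ω') (hsub : Ω' ⊆ Ω) :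
    IsConformalWith g ρ Ω' :=
  ⟨hΩ', h.contDiffOn.mono hsub, h.contDiffOn_recip.mono hsub, fun x hx => h.pos x (hsub hx),
    fun x hx => h.inner_eq x (hsub hx)⟩

theorem dirDeriv_surjective [FiniteDimensional ℝ E] (h : IsConformalWith g ρ Ω) (hx : x ∈ Ω)
    (y : E) : ∃ w, dirDeriv w g x = y := by
  have hinj : Function.Injective (fderiv ℝ g x : E →ₗ[ℝ] E) := by
    rw [← LinearMap.ker_eq_bot, LinearMap.ker_eq_bot']
    intro u hu
    have h1 := h.inner_eq x hx u u
    have h2 : dirDeriv u g x = 0 := hu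
    rw [h2, inner_zero_left, mul_zero] at h1
    exact inner_self_eq_zero.1 h1.symm
  exact LinearMap.injective_iff_surjective.1 hinj y

theorem norm_dirDeriv (h : IsConformalWith g ρ Ω) (hx : x ∈ Ω) (w : E) :
    ρ x * ‖dirDeriv w g x‖ = ‖w‖ := by
  have h1 := h.inner_eq x hx w w
  rw [real_inner_self_eq_norm_sq, real_inner_self_eq_norm_sq, ← mul_pow] at h1
  exact (pow_left_inj₀ (mul_nonneg (h.pos x hx).le (norm_nonneg _)) (norm_nonneg _)
    two_ne_zero).1 h1

/-- The first derivative of the conformality relation. -/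
theorem inner_add_inner (h : IsConformalWith g ρ Ω) (hx : x ∈ Ω) (u v w : E) :
    ρ x * (⟪dirDeriv w (dirDeriv u g) x, dirDeriv v g x⟫ +
      ⟪dirDeriv u g x, dirDeriv w (dirDeriv v g) x⟫) =
      -2 * dirDeriv w ρ x * ⟪dirDeriv u g x, dirDeriv v g x⟫ := by
  have hu := (h.contDiffOn.dirDeriv h.isOpen u).differentiableAt_of_isOpen h.isOpen hx
  have hv := (h.contDiffOn.dirDeriv h.isOpen v).differentiableAt_of_isOpen h.isOpen hx
  have hρ := h.contDiffOn_recip.differentiableAt_of_isOpen h.isOpen hx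
  have h1 := dirDeriv_eq_zero_of_const h.isOpen ⟪u, v⟫
    (F := fun y => (ρ y * ρ y) * ⟪dirDeriv u g y, dirDeriv v g y⟫)
    (fun y hy => by rw [← h.inner_eq y hy u v, sq]) w hx
  rw [dirDeriv_mul (hρ.fun_mul hρ) (hu.inner ℝ hv), dirDeriv_mul hρ hρ, dirDeriv_inner hu hv] at h1
  have hpos := (h.pos x hx).ne'
  apply mul_left_cancel₀ hpos
  linear_combination h1

/-- The Koszul formula for the second derivatives of a conformal map. -/
theorem inner_dirDeriv_dirDeriv (h : IsConformalWith g ρ Ω) (hx : x ∈ Ω) (u v w : E) :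
    ρ x * ⟪dirDeriv u (dirDeriv v g) x, dirDeriv w g x⟫ =
      -dirDeriv v ρ x * ⟪dirDeriv u g x, dirDeriv w g x⟫
      - dirDeriv u ρ x * ⟪dirDeriv v g x, dirDeriv w g x⟫
      + dirDeriv w ρ x * ⟪dirDeriv u g x, dirDeriv v g x⟫ := by
  have h1 := h.inner_add_inner hx v w u
  have h2 := h.inner_add_inner hx u w v
  have h3 := h.inner_add_inner hx u v w
  have hc := fun a b => dirDeriv_comm h.contDiffOn h.isOpen a b hx
  rw [hc v u] at h2
  rw [hc w u, hc w v] at h3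
  rw [real_inner_comm (dirDeriv v (dirDeriv w g) x) (dirDeriv u g x)] at *
  rw [real_inner_comm (dirDeriv u (dirDeriv w g) x) (dirDeriv v g x)] at *
  linear_combination (h1 + h2 - h3) / 2

variable [FiniteDimensional ℝ E]

theorem norm_dirDeriv_dirDeriv_le (h : IsConformalWith g ρ Ω) (hx : x ∈ Ω) (u v : E) :
    ρ x ^ 2 * ‖dirDeriv u (dirDeriv v g) x‖ ≤ 3 * ‖fderiv ℝ ρ x‖ * ‖u‖ * ‖v‖ := by
  set y := dirDeriv u (dirDeriv v g) x with hy
  obtain ⟨w, hw⟩ := h.dirDeriv_surjective hx y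
  have h1 := h.inner_dirDeriv_dirDeriv hx u v w
  rw [← hy, hw, real_inner_self_eq_norm_sq] at h1
  have hp := h.pos x hx
  have hb : ∀ a b c : E, |dirDeriv a ρ x * (ρ x ^ 2 * ⟪dirDeriv b g x, dirDeriv c g x⟫)| ≤
      ‖fderiv ℝ ρ x‖ * ‖a‖ * (‖b‖ * ‖c‖) := by
    intro a b c
    rw [h.inner_eq x hx, abs_mul]
    exact mul_le_mul ((fderiv ℝ ρ x).le_opNorm a) (abs_real_inner_le_norm b c) (abs_nonneg _)
      (by positivity)
  have e1 := abs_le.1 (hb v u w)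
  have e2 := abs_le.1 (hb u v w)
  have e3 := abs_le.1 (hb w u v)
  rw [hw] at e1 e2
  have hwn : ‖w‖ = ρ x * ‖y‖ := by rw [← h.norm_dirDeriv hx w, hw]
  have h2 : ρ x ^ 3 * ‖y‖ ^ 2 ≤ 3 * ‖fderiv ℝ ρ x‖ * ‖u‖ * ‖v‖ * (ρ x * ‖y‖) := by
    rw [← hwn]
    nlinarith [e1.1, e2.1, e3.2, h1]
  rcases (norm_nonneg y).eq_or_lt with h0 | h0
  · rw [← h0, mul_zero]; positivity
  · have : (ρ x * ‖y‖) * (ρ x ^ 2 * ‖y‖) ≤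
        (ρ x * ‖y‖) * (3 * ‖fderiv ℝ ρ x‖ * ‖u‖ * ‖v‖) := by linarith
    exact le_of_mul_le_mul_left this (by positivity)

/-- For orthogonal `u`, `v` the mixed second derivative of `ρ g` has no first-order terms. -/
theorem dirDeriv_dirDeriv_smul_of_inner_eq_zero (h : IsConformalWith g ρ Ω) (hx : x ∈ Ω)
    {u v : E} (huv : ⟪u, v⟫ = 0) :
    dirDeriv u (dirDeriv v (fun y => ρ y • g y)) x = dirDeriv u (dirDeriv v ρ) x • g x := by
  rw [dirDeriv_dirDeriv_smul h.isOpen h.contDiffOn_recip h.contDiffOn u v hx]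
  have key : dirDeriv v ρ x • dirDeriv u g x + dirDeriv u ρ x • dirDeriv v g x +
      ρ x • dirDeriv u (dirDeriv v g) x = 0 := by
    refine ext_inner_right ℝ fun y => ?_
    obtain ⟨w, rfl⟩ := h.dirDeriv_surjective hx y
    have h1 := h.inner_dirDeriv_dirDeriv hx u v w
    have h2 := h.inner_eq x hx u v
    have h3 : ⟪dirDeriv u g x, dirDeriv v g x⟫ = 0 := by
      rw [huv] at h2
      exact (mul_eq_zero.1 h2).resolve_left (pow_ne_zero _ (h.pos x hx).ne')
    rw [h3] at h1
    simp only [inner_add_left, real_inner_smul_left, inner_zero_left]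
    linear_combination h1
  calc _ = dirDeriv u (dirDeriv v ρ) x • g x + (dirDeriv v ρ x • dirDeriv u g x +
        dirDeriv u ρ x • dirDeriv v g x + ρ x • dirDeriv u (dirDeriv v g) x) := by abel
    _ = _ := by rw [key, add_zero]

/-- The mixed second derivatives of `ρ` in orthogonal directions `u`, `v` vanish: choose a third
direction `w` orthogonal to both; the symmetry in `v` and `w` of the third derivative of `ρ g`
gives `ρ_uv g_w = ρ_uw g_v`, and `g_v`, `g_w` are linearly independent. -/
theorem dirDeriv_dirDeriv_recip_of_inner_eq_zero (hd : 3 ≤ Module.finrank ℝ E)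
    (h : IsConformalWith g ρ Ω) (hx : x ∈ Ω) {u v : E} (huv : ⟪u, v⟫ = 0) :
    dirDeriv u (dirDeriv v ρ) x = 0 := by
  obtain ⟨w, hw, huw, hvw⟩ := exists_norm_eq_one_orthogonal hd u v
  have hH : ContDiffOn ℝ ∞ (fun y => ρ y • g y) Ω := h.contDiffOn_recip.smul h.contDiffOn
  have third : ∀ {a b c : E}, ⟪a, b⟫ = 0 →
      dirDeriv c (dirDeriv a (dirDeriv b (fun y => ρ y • g y))) x =
        dirDeriv a (dirDeriv b ρ) x • dirDeriv c g x +
          dirDeriv c (dirDeriv a (dirDeriv b ρ)) x • g x := by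
    intro a b c hab
    rw [dirDeriv_congr h.isOpen
      (fun y hy => h.dirDeriv_dirDeriv_smul_of_inner_eq_zero hy hab) c hx]
    exact dirDeriv_smul (((h.contDiffOn_recip.dirDeriv h.isOpen b).dirDeriv h.isOpen
      a).differentiableAt_of_isOpen h.isOpen hx)
      (h.contDiffOn.differentiableAt_of_isOpen h.isOpen hx) c
  have e1 := third (c := w) huv
  rw [dirDeriv_swap hH h.isOpen u v w hx, third (c := v) huw,
    dirDeriv_swap h.contDiffOn_recip h.isOpen u v w hx] at e1
  have e2 := add_right_cancel e1
  have hvw' := h.inner_eq x hx v w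
  have hww := h.inner_eq x hx w w
  rw [hvw] at hvw'
  rw [real_inner_self_eq_norm_sq w, hw] at hww
  have h3 := congrArg (fun y => ρ x ^ 2 * ⟪y, dirDeriv w g x⟫) e2
  simp only [real_inner_smul_left] at h3
  linear_combination -h3 + dirDeriv u (dirDeriv w ρ) x * hvw' -
    dirDeriv u (dirDeriv v ρ) x * hww

/-- A smooth function whose mixed second derivatives in orthogonal directions vanish has the same
constant second derivative in all unit directions: for `w ⟂ u`, `F_uuw = F_uwu = 0`. -/
theorem _root_.dirDeriv_dirDeriv_eq_inner_smul {G : Type*} [NormedAddCommGroup G]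
    [InnerProductSpace ℝ G] (hd : 3 ≤ Module.finrank ℝ E) {F : E → G} (hΩ : IsOpen Ω)
    (hF : ContDiffOn ℝ ∞ F Ω)
    (h0 : ∀ x ∈ Ω, ∀ u v : E, ⟪u, v⟫ = 0 → dirDeriv u (dirDeriv v F) x = 0)
    {e : E} (he : ‖e‖ = 1) (hx : x ∈ Ω) :
    (∀ u v, dirDeriv u (dirDeriv v F) x = ⟪u, v⟫ • dirDeriv e (dirDeriv e F) x) ∧
      ∀ w, dirDeriv w (dirDeriv e (dirDeriv e F)) x = 0 := by
  have hform := fun y (hy : y ∈ Ω) (u v : E) => dirDeriv_dirDeriv hF hΩ u v hy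
  have main : ∀ y ∈ Ω, ∀ {e : E}, ‖e‖ = 1 → ∀ u v,
      dirDeriv u (dirDeriv v F) y = ⟪u, v⟫ • dirDeriv e (dirDeriv e F) y := by
    intro y hy e he u v
    refine ext_inner_left ℝ fun z => ?_
    let β : E →ₗ[ℝ] E →ₗ[ℝ] ℝ := LinearMap.mk₂ ℝ
      (fun a b => ⟪z, fderiv ℝ (fderiv ℝ F) y a b⟫)
      (by intros; simp [inner_add_right]) (by intros; simp [inner_smul_right])
      (by intros; simp [inner_add_right]) (by intros; simp [inner_smul_right])
    have := bilin_eq_inner_mul_of_orthogonal β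
      (fun a b => by
        simp only [β, LinearMap.mk₂_apply]
        rw [← hform y hy, ← hform y hy, dirDeriv_comm hF hΩ a b hy])
      (fun a b hab => by
        simp only [β, LinearMap.mk₂_apply]
        rw [← hform y hy, h0 y hy a b hab, inner_zero_right]) he u v
    simp only [β, LinearMap.mk₂_apply] at this
    rw [← hform y hy, ← hform y hy] at this
    rw [this, real_inner_smul_right]
  refine ⟨main x hx he, fun w => ?_⟩
  obtain ⟨u, hu, hwu, -⟩ := exists_norm_eq_one_orthogonal hd w w
  have h1 : ∀ y ∈ Ω, dirDeriv e (dirDeriv e F) y = dirDeriv u (dirDeriv u F) y := by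
    intro y hy
    rw [main y hy hu e e, real_inner_self_eq_norm_sq, he]
    simp
  rw [dirDeriv_congr hΩ h1 w hx, dirDeriv_comm (hF.dirDeriv hΩ u) hΩ w u hx]
  exact dirDeriv_eq_zero_of_const hΩ 0
    (fun y hy => h0 y hy w u hwu) u hx

/-- The gradient `z` of `ρ` satisfies `|z| ^ 2 = 2 α ρ`, where `α` is the second derivative of `ρ`
in unit directions. With `Y = (ρ g)_ee - α g` the Koszul formula gives `ρ ^ 2 ⟪Y, g_w⟫ = ρ_w`;
the relation is the derivative of this identity in the direction `w`, because `α` and `(ρ g)_ee`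
are constant. -/
theorem exists_gradient (hd : 3 ≤ Module.finrank ℝ E) (h : IsConformalWith g ρ Ω) (hx : x ∈ Ω)
    {e : E} (he : ‖e‖ = 1) :
    ∃ z : E, (∀ w, dirDeriv w ρ x = ⟪z, w⟫) ∧
      ‖z‖ ^ 2 = 2 * dirDeriv e (dirDeriv e ρ) x * ρ x := by
  set z : E := (InnerProductSpace.toDual ℝ E).symm (fderiv ℝ ρ x) with hz
  have hzw : ∀ w, dirDeriv w ρ x = ⟪z, w⟫ := fun w =>
    (InnerProductSpace.toDual_symm_apply (𝕜 := ℝ)).symm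
  refine ⟨z, hzw, ?_⟩
  have hΩ := h.isOpen
  have hρ0 := fun y (hy : y ∈ Ω) (u v : E) (huv : ⟪u, v⟫ = 0) =>
    h.dirDeriv_dirDeriv_recip_of_inner_eq_zero hd hy huv
  have hH : ContDiffOn ℝ ∞ (fun y => ρ y • g y) Ω := h.contDiffOn_recip.smul h.contDiffOn
  have hH0 : ∀ y ∈ Ω, ∀ u v : E, ⟪u, v⟫ = 0 →
      dirDeriv u (dirDeriv v (fun y => ρ y • g y)) y = 0 := by
    intro y hy u v huv
    rw [h.dirDeriv_dirDeriv_smul_of_inner_eq_zero hy huv, hρ0 y hy u v huv, zero_smul]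
  have hα := (dirDeriv_dirDeriv_eq_inner_smul hd hΩ h.contDiffOn_recip hρ0 he hx)
  have hB := (dirDeriv_dirDeriv_eq_inner_smul hd hΩ hH hH0 he hx)
  set α := dirDeriv e (dirDeriv e ρ) with hαdef
  set B := dirDeriv e (dirDeriv e (fun y => ρ y • g y)) with hBdef
  have hαd : DifferentiableAt ℝ α x :=
    ((h.contDiffOn_recip.dirDeriv hΩ e).dirDeriv hΩ e).differentiableAt_of_isOpen hΩ hx
  have hBd : DifferentiableAt ℝ B x :=
    ((hH.dirDeriv hΩ e).dirDeriv hΩ e).differentiableAt_of_isOpen hΩ hx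
  have hgd := h.contDiffOn.differentiableAt_of_isOpen hΩ hx
  have hρd := h.contDiffOn_recip.differentiableAt_of_isOpen hΩ hx
  have key : ∀ y ∈ Ω, ∀ w, ρ y * ρ y * ⟪B y - α y • g y, dirDeriv w g y⟫ = dirDeriv w ρ y := by
    intro y hy w
    have h1 := h.inner_dirDeriv_dirDeriv hy e e w
    have h2 := h.inner_eq y hy e e
    rw [real_inner_self_eq_norm_sq e, he] at h2
    rw [hBdef, dirDeriv_dirDeriv_smul hΩ h.contDiffOn_recip h.contDiffOn e e hy]
    simp only [inner_add_left, inner_sub_left, real_inner_smul_left, ← hαdef]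
    linear_combination ρ y ^ 2 * h1 + dirDeriv w ρ y * h2
  have hwd := (h.contDiffOn.dirDeriv hΩ e).differentiableAt_of_isOpen hΩ hx
  -- `ρ ^ 2 ⟪Y, g_e⟫ = ρ_e` is now differentiated in the direction `e`.
  have hY : DifferentiableAt ℝ (fun y => B y - α y • g y) x := hBd.fun_sub (hαd.fun_smul hgd)
  have hdY : dirDeriv e (fun y => B y - α y • g y) x = -(α x • dirDeriv e g x) := by
    rw [dirDeriv_sub hBd (hαd.fun_smul hgd), dirDeriv_smul hαd hgd, hα.2 e, hB.2 e]
    simp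
  have d1 := dirDeriv_congr hΩ (fun y hy => key y hy e) e hx
  rw [dirDeriv_mul (hρd.fun_mul hρd) (hY.inner ℝ hwd), dirDeriv_mul hρd hρd,
    dirDeriv_inner hY hwd, hdY] at d1
  -- The same identity at `x` says that `Y` is the image of the gradient under `g'(x)`.
  obtain ⟨a, ha⟩ := h.dirDeriv_surjective hx (B x - α x • g x)
  have haz : a = z := by
    refine ext_inner_right ℝ fun w => ?_
    rw [← hzw, ← key x hx w, ← ha, ← h.inner_eq x hx a w, sq]
  rw [haz] at ha
  have k1 := key x hx e
  have k2 := h.inner_eq x hx e e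
  have k3 := h.inner_dirDeriv_dirDeriv hx e e z
  have k4 := h.inner_eq x hx z e
  rw [← ha] at d1 k1
  rw [real_inner_self_eq_norm_sq e, he] at k2
  rw [← hzw e] at k4
  rw [hzw z, real_inner_self_eq_norm_sq z] at k3
  rw [real_inner_comm (dirDeriv z g x)] at k3
  rw [real_inner_comm (dirDeriv z g x) (dirDeriv e g x)] at k3
  simp only [inner_neg_left, real_inner_smul_left] at d1
  change _ = α x at d1
  linear_combination ρ x * d1 - ρ x ^ 2 * k3 + (α x * ρ x - ‖z‖ ^ 2) * k2

/-- On a connected set the reciprocal scaling factor is a quadratic polynomial. -/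
theorem exists_quadratic (hd : 3 ≤ Module.finrank ℝ E) (h : IsConformalWith g ρ Ω)
    (hc : IsPreconnected Ω) {a : E} (ha : a ∈ Ω) :
    ∃ (α : ℝ) (z : E), (∀ w, dirDeriv w ρ a = ⟪z, w⟫) ∧ ‖z‖ ^ 2 = 2 * α * ρ a ∧
      ∀ x ∈ Ω, ρ x = ρ a + ⟪z, x - a⟫ + α / 2 * ‖x - a‖ ^ 2 := by
  obtain ⟨e, he, -, -⟩ := exists_norm_eq_one_orthogonal hd 0 0
  obtain ⟨z, hz, hzα⟩ := h.exists_gradient hd ha he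
  set α := dirDeriv e (dirDeriv e ρ) a with hα
  have hΩ := h.isOpen
  have hρ := h.contDiffOn_recip
  have hρ0 := fun y (hy : y ∈ Ω) =>
    (dirDeriv_dirDeriv_eq_inner_smul hd hΩ hρ (fun y hy u v huv =>
      h.dirDeriv_dirDeriv_recip_of_inner_eq_zero hd hy huv) he hy)
  have hαc : ∀ x ∈ Ω, dirDeriv e (dirDeriv e ρ) x = α := fun x hx =>
    eq_of_dirDeriv_eq_zero hΩ hc
      (((hρ.dirDeriv hΩ e).dirDeriv hΩ e).differentiableOn (by simp))
      (fun y hy => (hρ0 y hy).2) hx ha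
  have hsub : ∀ x w : E, dirDeriv w (fun y : E => y - a) x = w := by
    intro x w
    rw [dirDeriv, fderiv_sub_const]
    simp
  have hconst : ∀ x w u : E, dirDeriv w (fun _ : E => u) x = 0 := by
    intro x w u
    simp [dirDeriv]
  have dsub : ∀ x : E, DifferentiableAt ℝ (fun y : E => y - a) x := fun x => by fun_prop
  have dconst : ∀ x u : E, DifferentiableAt ℝ (fun _ : E => u) x := fun x u => by fun_prop
  have hlin : ∀ x ∈ Ω, ∀ u, dirDeriv u ρ x = ⟪z, u⟫ + α * ⟪u, x - a⟫ := by
    intro x hx u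
    have d1 : ∀ y ∈ Ω, DifferentiableAt ℝ (dirDeriv u ρ) y := fun y hy =>
      (hρ.dirDeriv hΩ u).differentiableAt_of_isOpen hΩ hy
    have d2 : ∀ y, DifferentiableAt ℝ (fun y : E => ⟪α • u, y - a⟫) y := fun y =>
      (dconst y (α • u)).inner ℝ (dsub y)
    have h1 := eq_of_dirDeriv_eq_zero hΩ hc
      (F := fun y => dirDeriv u ρ y - ⟪α • u, y - a⟫)
      (fun y hy => ((d1 y hy).fun_sub (d2 y)).differentiableWithinAt)
      (fun y hy w => by
        rw [dirDeriv_sub (d1 y hy) (d2 y), dirDeriv_inner (dconst y _) (dsub y), hsub, hconst,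
          (hρ0 y hy).1 w u, hαc y hy, real_inner_smul_left, inner_zero_left,
          real_inner_comm w u, smul_eq_mul]
        ring) hx ha
    simp only [sub_self, inner_zero_right, real_inner_smul_left, hz u] at h1
    linarith
  refine ⟨α, z, hz, hzα, fun x hx => ?_⟩
  have d1 : ∀ y ∈ Ω, DifferentiableAt ℝ ρ y := fun y hy =>
    hρ.differentiableAt_of_isOpen hΩ hy
  have d2 : ∀ y, DifferentiableAt ℝ (fun y : E => ⟪z, y - a⟫) y := fun y =>
    (dconst y z).inner ℝ (dsub y)
  have d3 : ∀ y, DifferentiableAt ℝ (fun y : E => ⟪y - a, y - a⟫) y := fun y =>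
    (dsub y).inner ℝ (dsub y)
  have d4 : ∀ y, DifferentiableAt ℝ (fun _ : E => α / 2) y := fun y => by fun_prop
  have h1 := eq_of_dirDeriv_eq_zero hΩ hc
    (F := fun y => ρ y - (⟪z, y - a⟫ + α / 2 * ⟪y - a, y - a⟫))
    (fun y hy => ((d1 y hy).fun_sub ((d2 y).fun_add
      ((d4 y).fun_mul (d3 y)))).differentiableWithinAt)
    (fun y hy w => by
      rw [dirDeriv_sub (d1 y hy) ((d2 y).fun_add ((d4 y).fun_mul (d3 y))),
        dirDeriv_add (d2 y) ((d4 y).fun_mul (d3 y)), dirDeriv_mul (d4 y) (d3 y),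
        dirDeriv_inner (dconst y _) (dsub y), dirDeriv_inner (dsub y) (dsub y), hsub, hconst,
        hlin y hy, inner_zero_left, real_inner_comm w (y - a)]
      simp [dirDeriv]
      ring) hx ha
  simp only [sub_self, inner_zero_right, mul_zero, add_zero, sub_zero,
    real_inner_self_eq_norm_sq] at h1
  linarith

end IsConformalWith

theorem isConformalWith_of_ne_zero {g : E → E} {Ω : Set E} (hΩ : IsOpen Ω)
    (hg : ContDiffOn ℝ ∞ g Ω)
    (hconf : ∀ x ∈ Ω, ∀ u v : E, ⟪u, v⟫ = 0 → ⟪dirDeriv u g x, dirDeriv v g x⟫ = 0)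
    {e : E} (he : ‖e‖ = 1) (h0 : ∀ x ∈ Ω, dirDeriv e g x ≠ 0) :
    IsConformalWith g (fun x => ‖dirDeriv e g x‖⁻¹) Ω where
  isOpen := hΩ
  contDiffOn := hg
  contDiffOn_recip := ((hg.dirDeriv hΩ e).norm ℝ h0).inv fun x hx => norm_ne_zero_iff.2 (h0 x hx)
  pos x hx := inv_pos.2 (norm_pos_iff.2 (h0 x hx))
  inner_eq x hx u v := by
    rw [inner_dirDeriv_eq_of_orthogonal (hconf x hx) he]
    have := norm_ne_zero_iff.2 (h0 x hx)
    field_simp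

/-- A conformal map with critical points allowed, on a connected open set in dimension at least
three, has no critical points unless it is constant: on a component of the complement of the
critical set the reciprocal scaling factor is a polynomial, so it stays bounded and the scaling
factor does not tend to `0` at a boundary point. -/
theorem isConformalWith_of_exists_ne_zero [FiniteDimensional ℝ E]
    (hd : 3 ≤ Module.finrank ℝ E) {g : E → E} {D : Set E} (hD : IsOpen D)
    (hDc : IsPreconnected D) (hg : ContDiffOn ℝ ∞ g D)
    (hconf : ∀ x ∈ D, ∀ u v : E, ⟪u, v⟫ = 0 → ⟪dirDeriv u g x, dirDeriv v g x⟫ = 0)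
    {e : E} (he : ‖e‖ = 1) {b : E} (hb : b ∈ D) (h0 : dirDeriv e g b ≠ 0) :
    IsConformalWith g (fun x => ‖dirDeriv e g x‖⁻¹) D := by
  have hcont : ContinuousOn (dirDeriv e g) D := (hg.dirDeriv hD e).continuousOn
  set S : Set E := D ∩ dirDeriv e g ⁻¹' {0}ᶜ with hS
  have hSo : IsOpen S := hcont.isOpen_inter_preimage hD isOpen_compl_singleton
  set Ω := connectedComponentIn S b with hΩdef
  have hbΩ : b ∈ Ω := mem_connectedComponentIn ⟨hb, h0⟩
  have hΩS : Ω ⊆ S := connectedComponentIn_subset S b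
  have hΩo : IsOpen Ω := hSo.connectedComponentIn
  have hΩc : IsPreconnected Ω := isPreconnected_connectedComponentIn
  have hΩ := isConformalWith_of_ne_zero hΩo (hg.mono fun x hx => (hΩS hx).1)
    (fun x hx => hconf x (hΩS hx).1) he (fun x hx => (hΩS hx).2)
  obtain ⟨α, z, -, -, hq⟩ := hΩ.exists_quadratic hd hΩc hbΩ
  have hsub : D ⊆ Ω := by
    refine hDc.subset_of_closure_inter_subset hΩo ⟨b, hb, hbΩ⟩ ?_
    rintro y ⟨hyc, hyD⟩
    -- `m` is the scaling factor times the polynomial, so it is `1` on `Ω` and, by continuity, at `y`.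
    set m : E → ℝ := fun x => ‖dirDeriv e g x‖ *
      (‖dirDeriv e g b‖⁻¹ + ⟪z, x - b⟫ + α / 2 * ‖x - b‖ ^ 2) with hm
    have hm1 : ∀ x ∈ Ω, m x = 1 := by
      intro x hx
      rw [hm]
      simp only
      rw [← hq x hx]
      exact mul_inv_cancel₀ (norm_ne_zero_iff.2 (hΩS hx).2)
    have hmc : ContinuousAt m y := by
      have := (hcont.continuousAt (hD.mem_nhds hyD)).norm
      refine this.mul (Continuous.continuousAt ?_)
      fun_prop
    have hmy : m y = 1 := by
      have : (nhdsWithin y Ω).NeBot := mem_closure_iff_nhdsWithin_neBot.1 hyc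
      refine tendsto_nhds_unique (hmc.mono_left (nhdsWithin_le_nhds (s := Ω))) ?_
      exact tendsto_const_nhds.congr'
        (Filter.eventuallyEq_of_mem self_mem_nhdsWithin fun x hx => (hm1 x hx).symm)
    have hy0 : dirDeriv e g y ≠ 0 := by
      intro hy0
      simp [hm, hy0] at hmy
    have hins : IsPreconnected (insert y Ω) :=
      hΩc.subset_closure (Set.subset_insert y Ω)
        (Set.insert_subset hyc subset_closure)
    exact hins.subset_connectedComponentIn (Set.mem_insert_of_mem y hbΩ)
      (Set.insert_subset (show y ∈ S from ⟨hyD, hy0⟩) hΩS) (Set.mem_insert y Ω)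
  exact isConformalWith_of_ne_zero hD hg hconf he fun x hx => (hΩS (hsub hx)).2

/-! ### A priori bounds for bounded conformal maps -/

namespace IsConformalWith

variable [FiniteDimensional ℝ E] {g : E → E} {ρ : E → ℝ} {a : E} {R : ℝ}

/-- The gradient bound for the reciprocal scaling factor: by the relation `|∇ρ| ^ 2 = 2 α ρ` the
quadratic polynomial `ρ` vanishes at a point at distance `2 ρ(a) / |∇ρ(a)|` from `a`, and this
point has to lie outside the ball. -/
theorem norm_gradient_le (hd : 3 ≤ Module.finrank ℝ E) (hR : 0 < R)
    (h : IsConformalWith g ρ (Metric.ball a R)) :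
    ‖fderiv ℝ ρ a‖ * R ≤ 2 * ρ a ∧
      ∀ x ∈ Metric.ball a R, ρ a - ‖fderiv ℝ ρ a‖ * ‖x - a‖ ≤ ρ x := by
  have ha : a ∈ Metric.ball a R := Metric.mem_ball_self hR
  have hpos := h.pos a ha
  obtain ⟨α, z, hz, hzα, hq⟩ := h.exists_quadratic hd (convex_ball a R).isPreconnected ha
  have hzn : ‖fderiv ℝ ρ a‖ = ‖z‖ := by
    have : fderiv ℝ ρ a = InnerProductSpace.toDual ℝ E z := by
      ext w
      rw [InnerProductSpace.toDual_apply_apply]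
      exact hz w
    rw [this, LinearIsometryEquiv.norm_map]
  rw [hzn]
  have hα : 0 ≤ α := by
    by_contra! hneg
    nlinarith [sq_nonneg ‖z‖]
  constructor
  · by_contra! hlt
    have hz0 : 0 < ‖z‖ := by
      by_contra! hz0
      nlinarith
    -- `s = 1 / α`, so that `ρ (a - t z) = ρ a * (1 - α t) ^ 2` vanishes at `t = s`.
    set s : ℝ := 2 * ρ a / ‖z‖ ^ 2 with hs
    have hs0 : 0 < s := by positivity
    have hsz : s * ‖z‖ ^ 2 = 2 * ρ a := by rw [hs]; field_simp
    have hn : ‖a - s • z - a‖ = s * ‖z‖ := by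
      rw [sub_sub_cancel_left, norm_neg, norm_smul, Real.norm_of_nonneg hs0.le]
    have hy : a - s • z ∈ Metric.ball a R := by
      rw [mem_ball_iff_norm, hn]
      by_contra! hge
      nlinarith
    have h1 := hq _ hy
    have h2 := h.pos _ hy
    rw [hn, sub_sub_cancel_left, inner_neg_right, real_inner_smul_right,
      real_inner_self_eq_norm_sq] at h1
    have h3 : α * s = 1 := by
      have : (α * s - 1) * (2 * ρ a) = 0 := by linear_combination hsz - s * hzα
      rcases mul_eq_zero.1 this with h | h <;> linarith
    have h4 : ρ (a - s • z) = 0 := by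
      linear_combination h1 + (s * ‖z‖ ^ 2 / 2) * h3 - hsz / 2
    linarith
  · intro x hx
    rw [hq x hx]
    have h1 := neg_le_of_abs_le (abs_real_inner_le_norm z (x - a))
    have : 0 ≤ α / 2 * ‖x - a‖ ^ 2 := by positivity
    linarith

/-- A quantitative form of conformality at the centre of a ball: the second derivative is
controlled by the scaling factor `1 / ρ(a)`. -/
theorem norm_sub_sub_le (hd : 3 ≤ Module.finrank ℝ E) (hR : 0 < R)
    (h : IsConformalWith g ρ (Metric.ball a R)) {v : E} (hv : ‖v‖ ≤ R / 4) :
    ‖g (a + v) - g a - fderiv ℝ g a v‖ ≤ 16 / (R * ρ a) * ‖v‖ ^ 2 := by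
  have ha : a ∈ Metric.ball a R := Metric.mem_ball_self hR
  have hpos := h.pos a ha
  have hsub : Metric.closedBall a ‖v‖ ⊆ Metric.ball a R :=
    Metric.closedBall_subset_ball (by linarith)
  have hsecond : ∀ x ∈ Metric.closedBall a ‖v‖, ∀ u w,
      ‖dirDeriv w (dirDeriv u g) x‖ ≤ 16 / (R * ρ a) * ‖u‖ * ‖w‖ := by
    intro x hx u w
    have hxa : ‖x - a‖ ≤ R / 4 := (mem_closedBall_iff_norm.1 hx).trans hv
    have h1 := h.norm_gradient_le hd hR
    have h2 : ρ a / 2 ≤ ρ x := by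
      have := h1.2 x (hsub hx)
      nlinarith [norm_nonneg (fderiv ℝ ρ a)]
    -- The gradient bound is used again, on the ball of radius `3 R / 4` about `x`.
    have h3 := ((h.mono (Metric.isOpen_ball (x := x) (ε := 3 * R / 4))
      (Metric.ball_subset_ball' (by rw [dist_eq_norm]; linarith))).norm_gradient_le hd
        (by linarith)).1
    have h4 := h.norm_dirDeriv_dirDeriv_le (hsub hx) w u
    have hx0 : 0 < ρ x := by linarith
    have h5 : ρ x * (R * ‖dirDeriv w (dirDeriv u g) x‖) ≤ 8 * (‖w‖ * ‖u‖) := by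
      have h6 : R * (ρ x ^ 2 * ‖dirDeriv w (dirDeriv u g) x‖) ≤
          8 * ρ x * (‖w‖ * ‖u‖) := by
        calc _ ≤ R * (3 * ‖fderiv ℝ ρ x‖ * ‖w‖ * ‖u‖) := by gcongr
          _ = (3 * R * ‖fderiv ℝ ρ x‖) * (‖w‖ * ‖u‖) := by ring
          _ ≤ _ := mul_le_mul_of_nonneg_right (by linarith) (by positivity)
      refine le_of_mul_le_mul_left (a := ρ x) ?_ hx0
      linarith
    have h7 : ρ a / 2 * (R * ‖dirDeriv w (dirDeriv u g) x‖) ≤ 8 * (‖w‖ * ‖u‖) :=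
      (mul_le_mul_of_nonneg_right h2 (by positivity)).trans h5
    have h8 : 16 / (R * ρ a) * ‖u‖ * ‖w‖ = (16 * (‖w‖ * ‖u‖)) / (R * ρ a) := by ring
    rw [h8, le_div_iff₀ (by positivity)]
    linarith
  have hconv := convex_closedBall a ‖v‖
  have hac : a ∈ Metric.closedBall a ‖v‖ := Metric.mem_closedBall_self (norm_nonneg v)
  -- Two applications of the mean value inequality.
  have hfirst : ∀ x ∈ Metric.closedBall a ‖v‖,
      ‖fderiv ℝ g x - fderiv ℝ g a‖ ≤ 16 / (R * ρ a) * ‖v‖ := by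
    intro x hx
    refine ContinuousLinearMap.opNorm_le_bound _ (by positivity) fun u => ?_
    have h1 := hconv.norm_image_sub_le_of_norm_fderiv_le (f := dirDeriv u g)
      (C := 16 / (R * ρ a) * ‖u‖)
      (fun y hy => (h.contDiffOn.dirDeriv h.isOpen u).differentiableAt_of_isOpen h.isOpen
        (hsub hy))
      (fun y hy => ContinuousLinearMap.opNorm_le_bound _ (by positivity) (hsecond y hy u)) hac hx
    calc _ ≤ 16 / (R * ρ a) * ‖u‖ * ‖x - a‖ := h1
      _ ≤ 16 / (R * ρ a) * ‖u‖ * ‖v‖ := by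
          gcongr
          exact mem_closedBall_iff_norm.1 hx
      _ = _ := by ring
  have h1 := hconv.norm_image_sub_le_of_norm_fderiv_le' (f := g)
    (fun y hy => h.contDiffOn.differentiableAt_of_isOpen h.isOpen (hsub hy)) hfirst hac
    (show a + v ∈ Metric.closedBall a ‖v‖ by simp)
  rw [add_sub_cancel_left] at h1
  linarith

end IsConformalWith

/-- Interior estimates for bounded conformal maps with critical points allowed. -/
theorem norm_fderiv_le_of_conformal [FiniteDimensional ℝ E] (hd : 3 ≤ Module.finrank ℝ E)
    {g : E → E} {a : E} {R c : ℝ} (hR : 0 < R) (hg : ContDiffOn ℝ ∞ g (Metric.ball a R))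
    (hconf : ∀ x ∈ Metric.ball a R, ∀ u v : E, ⟪u, v⟫ = 0 →
      ⟪fderiv ℝ g x u, fderiv ℝ g x v⟫ = 0)
    (hbound : ∀ x ∈ Metric.ball a R, ‖g x‖ ≤ c) :
    ‖fderiv ℝ g a‖ ≤ 128 * c / R ∧ ∀ v, ‖v‖ ≤ R / 4 →
      ‖g (a + v) - g a - fderiv ℝ g a v‖ ≤ 2048 * c / R ^ 2 * ‖v‖ ^ 2 := by
  have ha : a ∈ Metric.ball a R := Metric.mem_ball_self hR
  have hc : 0 ≤ c := (norm_nonneg _).trans (hbound a ha)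
  obtain ⟨e, he, -, -⟩ := exists_norm_eq_one_orthogonal hd 0 0
  have hDc := (convex_ball a R).isPreconnected
  by_cases h0 : ∃ b ∈ Metric.ball a R, dirDeriv e g b ≠ 0
  · obtain ⟨b, hb, hb0⟩ := h0
    have h := isConformalWith_of_exists_ne_zero hd Metric.isOpen_ball hDc hg hconf he hb hb0
    set ρ : E → ℝ := fun x => ‖dirDeriv e g x‖⁻¹ with hρ
    have hpos := h.pos a ha
    -- On a step of length `R / 32` the linear part of `g` dominates the quadratic remainder.
    have hinv : (ρ a)⁻¹ ≤ 128 * c / R := by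
      have hn : ‖(R / 32) • e‖ = R / 32 := by
        rw [norm_smul, he, mul_one, Real.norm_of_nonneg (by positivity)]
      have h1 := h.norm_sub_sub_le hd hR (v := (R / 32) • e) (by rw [hn]; linarith)
      have h2 := h.norm_dirDeriv ha ((R / 32) • e)
      have h3 : a + (R / 32) • e ∈ Metric.ball a R := by
        rw [mem_ball_iff_norm, add_sub_cancel_left, hn]; linarith
      have h4 : ‖fderiv ℝ g a ((R / 32) • e)‖ ≤ 16 / (R * ρ a) * (R / 32) ^ 2 + 2 * c := by
        have e1 := norm_sub_le (g (a + (R / 32) • e) - g a)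
          (g (a + (R / 32) • e) - g a - fderiv ℝ g a ((R / 32) • e))
        rw [sub_sub_cancel] at e1
        have e2 := norm_sub_le (g (a + (R / 32) • e)) (g a)
        have e3 := hbound _ h3
        have e4 := hbound _ ha
        rw [hn] at h1
        linarith
      have h5 : ‖fderiv ℝ g a ((R / 32) • e)‖ = R / 32 * (ρ a)⁻¹ := by
        rw [← div_eq_mul_inv, eq_div_iff hpos.ne', mul_comm]
        exact h2.trans hn
      have h6 : 16 / (R * ρ a) * (R / 32) ^ 2 = R / 64 * (ρ a)⁻¹ := by field_simp; norm_num
      rw [h5, h6] at h4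
      rw [le_div_iff₀ hR]
      linarith
    refine ⟨ContinuousLinearMap.opNorm_le_bound _ (by positivity) fun u => ?_, fun v hv => ?_⟩
    · have h2 := h.norm_dirDeriv ha u
      calc ‖fderiv ℝ g a u‖ = (ρ a)⁻¹ * (ρ a * ‖dirDeriv u g a‖) := by
            rw [inv_mul_cancel_left₀ hpos.ne']; rfl
        _ = (ρ a)⁻¹ * ‖u‖ := by rw [h2]
        _ ≤ _ := by gcongr
    · calc _ ≤ 16 / (R * ρ a) * ‖v‖ ^ 2 := h.norm_sub_sub_le hd hR hv
        _ = 16 / R * (ρ a)⁻¹ * ‖v‖ ^ 2 := by field_simp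
        _ ≤ 16 / R * (128 * c / R) * ‖v‖ ^ 2 := by gcongr
        _ = _ := by field_simp; ring
  · push Not at h0
    have hz : ∀ x ∈ Metric.ball a R, ∀ u, dirDeriv u g x = 0 := by
      intro x hx u
      have := inner_dirDeriv_eq_of_orthogonal (hconf x hx) he u u
      rw [h0 x hx, norm_zero] at this
      exact (inner_self_eq_zero (𝕜 := ℝ)).1 (this.trans (by simp))
    have hz' : fderiv ℝ g a = 0 := ContinuousLinearMap.ext (hz a ha)
    refine ⟨by rw [hz', norm_zero]; positivity, fun v hv => ?_⟩
    have hav : a + v ∈ Metric.ball a R := by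
      rw [mem_ball_iff_norm, add_sub_cancel_left]; linarith
    rw [eq_of_dirDeriv_eq_zero Metric.isOpen_ball hDc (hg.differentiableOn (by simp)) hz hav ha,
      hz']
    simp only [sub_self, zero_apply, norm_zero]
    positivity

end Liouville

/-! ### Functions that are conformal in each variable -/

section Several

theorem partialFun_update {K : Type} {n : ℕ} (f : KSpace K n → K) (ξ : KSpace K n) (j : Fin n) (w : K) :
    partialFun f (WithLp.toLp 2 (Function.update (WithLp.ofLp ξ) j w)) j = partialFun f ξ j := by
  funext w'
  simp only [partialFun, Function.update_idem]

variable {K : Type} [NormedAddCommGroup K] [InnerProductSpace ℝ K] {n : ℕ}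

/-- `f` is smooth on `U` and, in each variable, its derivative at each point of `U` preserves
orthogonality: it is either a similarity or zero. -/
structure IsSeparatelyConformalOn (f : KSpace K n → K) (U : Set (KSpace K n)) : Prop where
  contDiffOn : ContDiffOn ℝ ∞ f U
  inner_eq_zero : ∀ ξ ∈ U, ∀ (j : Fin n) (u v : K), ⟪u, v⟫ = 0 →
    ⟪fderiv ℝ (partialFun f ξ j) (ξ j) u, fderiv ℝ (partialFun f ξ j) (ξ j) v⟫ = 0

/-- The inclusion of the `j`-th coordinate axis into `K ^ n`. -/
noncomputable def coordAxis (K : Type) [NormedAddCommGroup K] [InnerProductSpace ℝ K] {n : ℕ}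
    (j : Fin n) : K →ₗᵢ[ℝ] KSpace K n where
  toLinearMap := (WithLp.linearEquiv 2 ℝ (Fin n → K)).symm.toLinearMap ∘ₗ
    LinearMap.single ℝ (fun _ => K) j
  norm_map' x := PiLp.norm_single 2 (fun _ : Fin n => K) j x

theorem sum_coordAxis (z : KSpace K n) : ∑ j, coordAxis K j (z j) = z := by
  ext i
  rw [WithLp.ofLp_sum, Finset.sum_apply]
  change ∑ j, (Pi.single j (z j) : Fin n → K) i = z i
  simp [Pi.single_apply]

theorem toLp_update (ξ : KSpace K n) (j : Fin n) (w : K) :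
    WithLp.toLp 2 (Function.update (WithLp.ofLp ξ) j w) = ξ + coordAxis K j (w - ξ j) := by
  ext i
  change Function.update (WithLp.ofLp ξ) j w i = ξ i + (Pi.single j (w - ξ j) : Fin n → K) i
  rcases eq_or_ne i j with rfl | h
  · simp
  · simp [h]

theorem partialFun_eq (f : KSpace K n → K) (ξ : KSpace K n) (j : Fin n) :
    partialFun f ξ j = fun w => f (ξ + coordAxis K j (w - ξ j)) := by
  funext w
  rw [partialFun, toLp_update]

theorem fderiv_partialFun {f : KSpace K n → K} {ξ : KSpace K n} (hf : DifferentiableAt ℝ f ξ)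
    (j : Fin n) (u : K) :
    fderiv ℝ (partialFun f ξ j) (ξ j) u = fderiv ℝ f ξ (coordAxis K j u) := by
  rw [partialFun_eq]
  have h1 : HasFDerivAt (fun w => ξ + coordAxis K j (w - ξ j))
      (coordAxis K j).toContinuousLinearMap (ξ j) :=
    (((coordAxis K j).toContinuousLinearMap.hasFDerivAt).comp (ξ j)
      ((hasFDerivAt_id (ξ j)).sub_const (ξ j))).const_add ξ
  have h2 : HasFDerivAt f (fderiv ℝ f ξ) (ξ + coordAxis K j (ξ j - ξ j)) := by
    rw [sub_self, map_zero, add_zero]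
    exact hf.hasFDerivAt
  exact DFunLike.congr_fun (h2.comp (ξ j) h1).fderiv u

theorem norm_le_of_coordAxis {G : Type*} [NormedAddCommGroup G] [NormedSpace ℝ G]
    {T : KSpace K n →L[ℝ] G} {M : ℝ} (hM : 0 ≤ M)
    (h : ∀ j u, ‖u‖ = 1 → ‖T (coordAxis K j u)‖ ≤ M) : ‖T‖ ≤ n * M := by
  refine T.opNorm_le_bound (by positivity) fun z => ?_
  have hj : ∀ j, ‖T.comp (coordAxis K j).toContinuousLinearMap‖ ≤ M := fun j =>
    ContinuousLinearMap.opNorm_le_of_unit_norm hM (h j)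
  calc ‖T z‖ = ‖∑ j, T (coordAxis K j (z j))‖ := by rw [← map_sum, sum_coordAxis]
    _ ≤ ∑ j : Fin n, ‖T (coordAxis K j (z j))‖ := norm_sum_le _ _
    _ ≤ ∑ _j : Fin n, M * ‖z‖ := by
        refine Finset.sum_le_sum fun j _ => ?_
        calc _ ≤ M * ‖z j‖ := (T.comp (coordAxis K j).toContinuousLinearMap).le_of_opNorm_le
              (hj j) (z j)
          _ ≤ _ := by gcongr; exact PiLp.norm_apply_le z j
    _ = n * M * ‖z‖ := by simp [mul_assoc]

namespace IsSeparatelyConformalOn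

variable {f : KSpace K n → K} {U : Set (KSpace K n)} {ξ : KSpace K n}
  {R c : ℝ}

theorem differentiableAt_of_ball_subset (hf : IsSeparatelyConformalOn f U) (hR : 0 < R)
    (hU : Metric.ball ξ R ⊆ U) : DifferentiableAt ℝ f ξ :=
  (hf.contDiffOn.mono hU).differentiableAt_of_isOpen Metric.isOpen_ball
    (Metric.mem_ball_self hR)

variable [FiniteDimensional ℝ K]

/-- The interior estimates in each variable. -/
theorem norm_fderiv_coordAxis_le (hd : 3 ≤ Module.finrank ℝ K)
    (hf : IsSeparatelyConformalOn f U) (hR : 0 < R) (hU : Metric.ball ξ R ⊆ U)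
    (hbound : ∀ z ∈ U, ‖f z‖ ≤ c) (j : Fin n) :
    (∀ u, ‖fderiv ℝ f ξ (coordAxis K j u)‖ ≤ 128 * c / R * ‖u‖) ∧ ∀ u, ‖u‖ ≤ R / 4 →
      ‖f (ξ + coordAxis K j u) - f ξ - fderiv ℝ f ξ (coordAxis K j u)‖ ≤
        2048 * c / R ^ 2 * ‖u‖ ^ 2 := by
  have hmem : ∀ w ∈ Metric.ball (ξ j) R, ξ + coordAxis K j (w - ξ j) ∈ Metric.ball ξ R := by
    intro w hw
    rw [mem_ball_iff_norm, add_sub_cancel_left, LinearIsometry.norm_map]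
    exact mem_ball_iff_norm.1 hw
  have hsmooth : ContDiffOn ℝ ∞ (partialFun f ξ j) (Metric.ball (ξ j) R) := by
    rw [partialFun_eq]
    refine hf.contDiffOn.comp (t := U) ?_ fun w hw => hU (hmem w hw)
    exact (contDiff_const.add ((coordAxis K j).toContinuousLinearMap.contDiff.comp
      (contDiff_id.sub contDiff_const))).contDiffOn
  have hconf : ∀ w ∈ Metric.ball (ξ j) R, ∀ u v : K, ⟪u, v⟫ = 0 →
      ⟪fderiv ℝ (partialFun f ξ j) w u, fderiv ℝ (partialFun f ξ j) w v⟫ = 0 := by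
    intro w hw u v huv
    have h1 := hf.inner_eq_zero (WithLp.toLp 2 (Function.update (WithLp.ofLp ξ) j w))
      (by rw [toLp_update]; exact hU (hmem w hw)) j u v huv
    rw [partialFun_update] at h1
    simpa using h1
  have h := norm_fderiv_le_of_conformal hd hR hsmooth hconf (c := c) (fun w hw => by
    rw [partialFun_eq]
    exact hbound _ (hU (hmem w hw)))
  have hdiff := hf.differentiableAt_of_ball_subset hR hU
  refine ⟨fun u => ?_, fun u hu => ?_⟩
  · rw [← fderiv_partialFun hdiff]
    exact ContinuousLinearMap.le_of_opNorm_le _ h.1 u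
  · have h2 := h.2 u hu
    rw [fderiv_partialFun hdiff, partialFun_eq] at h2
    simpa using h2

theorem norm_fderiv_le (hd : 3 ≤ Module.finrank ℝ K)
    (hf : IsSeparatelyConformalOn f U) (hR : 0 < R) (hU : Metric.ball ξ R ⊆ U)
    (hbound : ∀ z ∈ U, ‖f z‖ ≤ c) : ‖fderiv ℝ f ξ‖ ≤ n * (128 * c / R) := by
  have hc : 0 ≤ c := (norm_nonneg _).trans (hbound ξ (hU (Metric.mem_ball_self hR)))
  refine norm_le_of_coordAxis (by positivity) fun j u hu => ?_
  have := (hf.norm_fderiv_coordAxis_le hd hR hU hbound j).1 u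
  rwa [hu, mul_one] at this

theorem norm_sub_le (hd : 3 ≤ Module.finrank ℝ K)
    (hf : IsSeparatelyConformalOn f U) (hR : 0 < R) (hU : Metric.ball ξ R ⊆ U)
    (hbound : ∀ z ∈ U, ‖f z‖ ≤ c) {z : KSpace K n} (hz : z ∈ Metric.ball ξ (R / 2)) :
    ‖f z - f ξ‖ ≤ n * (128 * c / (R / 2)) * ‖z - ξ‖ := by
  have hsub : ∀ y ∈ Metric.ball ξ (R / 2), Metric.ball y (R / 2) ⊆ U := fun y hy =>
    (Metric.ball_subset_ball' (by rw [Metric.mem_ball] at hy; linarith)).trans hU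
  exact (convex_ball ξ (R / 2)).norm_image_sub_le_of_norm_fderiv_le
    (fun y hy => hf.differentiableAt_of_ball_subset (half_pos hR) (hsub y hy))
    (fun y hy => hf.norm_fderiv_le hd (half_pos hR) (hsub y hy) hbound)
    (Metric.mem_ball_self (half_pos hR)) hz

/-- Interpolation: two bounded separately conformal functions that are uniformly close have close
derivatives, since the second derivatives in each variable are bounded. -/
theorem norm_fderiv_sub_fderiv_le (hd : 3 ≤ Module.finrank ℝ K) {f₁ f₂ : KSpace K n → K}
    (hf₁ : IsSeparatelyConformalOn f₁ U) (hf₂ : IsSeparatelyConformalOn f₂ U) (hR : 0 < R)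
    (hU : Metric.ball ξ R ⊆ U) (hb₁ : ∀ z ∈ U, ‖f₁ z‖ ≤ c) (hb₂ : ∀ z ∈ U, ‖f₂ z‖ ≤ c)
    {s : ℝ} (hs : 0 < s) (hsR : s ≤ R / 4)
    (hclose : ∀ z ∈ Metric.ball ξ R, ‖f₁ z - f₂ z‖ ≤ s ^ 2) :
    ‖fderiv ℝ f₁ ξ - fderiv ℝ f₂ ξ‖ ≤ n * ((2 + 4096 * c / R ^ 2) * s) := by
  have hc : 0 ≤ c := (norm_nonneg _).trans (hb₁ ξ (hU (Metric.mem_ball_self hR)))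
  refine norm_le_of_coordAxis (by positivity) fun j u hu => ?_
  have hsu : ‖s • u‖ = s := by rw [norm_smul, hu, mul_one, Real.norm_of_nonneg hs.le]
  have h1 := (hf₁.norm_fderiv_coordAxis_le hd hR hU hb₁ j).2 (s • u) (by rw [hsu]; exact hsR)
  have h2 := (hf₂.norm_fderiv_coordAxis_le hd hR hU hb₂ j).2 (s • u) (by rw [hsu]; exact hsR)
  have h3 := hclose ξ (Metric.mem_ball_self hR)
  have h4 := hclose (ξ + coordAxis K j (s • u)) (by
    rw [mem_ball_iff_norm, add_sub_cancel_left, LinearIsometry.norm_map, hsu]; linarith)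
  rw [hsu] at h1 h2
  set y := ξ + coordAxis K j (s • u)
  set A := fderiv ℝ f₁ ξ (coordAxis K j (s • u)) with hA
  set B := fderiv ℝ f₂ ξ (coordAxis K j (s • u)) with hB
  -- `A` and `B` are the increments of `f₁` and `f₂` along `s • u`, up to `O(s ^ 2)`.
  have h5 : ‖A - B‖ ≤ 2048 * c / R ^ 2 * s ^ 2 + 2048 * c / R ^ 2 * s ^ 2 + s ^ 2 + s ^ 2 := by
    have e : A - B = (f₂ y - f₂ ξ - B) - (f₁ y - f₁ ξ - A) + (f₁ y - f₂ y) - (f₁ ξ - f₂ ξ) := by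
      abel
    rw [e]
    refine (_root_.norm_sub_le _ _).trans (add_le_add ((norm_add_le _ _).trans
      (add_le_add ((_root_.norm_sub_le _ _).trans (add_le_add h2 h1)) h4)) h3)
  have h6 : ‖A - B‖ = s * ‖(fderiv ℝ f₁ ξ - fderiv ℝ f₂ ξ) (coordAxis K j u)‖ := by
    rw [hA, hB, map_smul, map_smul, map_smul, ← smul_sub, norm_smul, Real.norm_of_nonneg hs.le]
    rfl
  rw [h6] at h5
  refine le_of_mul_le_mul_left (h5.trans (le_of_eq ?_)) hs
  ring

end IsSeparatelyConformalOn

end Several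

/-! ### Compactness -/

/-- A bounded equicontinuous sequence on a compact set has a uniformly convergent subsequence. -/
theorem exists_subseq_tendstoUniformlyOn {E G : Type*} [PseudoMetricSpace E]
    [NormedAddCommGroup G] [ProperSpace G] {C : Set E} (hC : IsCompact C) (f : ℕ → E → G) {c : ℝ}
    (hcont : ∀ m, ContinuousOn (f m) C) (hbound : ∀ m, ∀ z ∈ C, ‖f m z‖ ≤ c)
    (hequi : ∀ x ∈ C, ∀ ε > 0, ∃ δ > 0, ∀ y ∈ C, dist y x < δ →
      ∀ m, dist (f m x) (f m y) < ε) :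
    ∃ φ : ℕ → ℕ, StrictMono φ ∧ ∃ g : E → G,
      TendstoUniformlyOn (fun k => f (φ k)) g Filter.atTop C := by
  have : CompactSpace C := isCompact_iff_compactSpace.1 hC
  let F : ℕ → BoundedContinuousFunction C G := fun m =>
    BoundedContinuousFunction.mkOfCompact ⟨C.domRestrict (f m), (hcont m).domRestrict⟩
  have hF : ∀ m (x : C), F m x = f m x := fun m x => rfl
  have hA := BoundedContinuousFunction.arzela_ascoli (Metric.closedBall (0 : G) c)
    (isCompact_closedBall 0 c) (Set.range F)
    (by
      rintro _ x ⟨m, rfl⟩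
      rw [mem_closedBall_zero_iff, hF]
      exact hbound m x x.2)
    (by
      intro x
      rw [Metric.equicontinuousAt_iff]
      intro ε hε
      obtain ⟨δ, hδ, h⟩ := hequi x x.2 ε hε
      refine ⟨δ, hδ, ?_⟩
      rintro y hy ⟨_, m, rfl⟩
      exact h y y.2 hy m)
  obtain ⟨g, -, φ, hφ, hg⟩ := hA.tendsto_subseq fun m => subset_closure (Set.mem_range_self m)
  classical
  refine ⟨φ, hφ, fun y => if h : y ∈ C then g ⟨y, h⟩ else 0, ?_⟩
  rw [tendstoUniformlyOn_iff_tendstoUniformly_comp_coe]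
  have h1 := BoundedContinuousFunction.tendsto_iff_tendstoUniformly.1 hg
  have hg' : (fun y => if h : y ∈ C then g ⟨y, h⟩ else 0) ∘ Subtype.val = g := by
    funext x
    simp
  rw [hg']
  exact h1

theorem uniformCauchySeqOn_of_norm {α G : Type*} [SeminormedAddCommGroup G] {F : ℕ → α → G}
    {s : Set α}
    (h : ∀ ε > 0, ∃ N : ℕ, ∀ m ≥ N, ∀ k ≥ N, ∀ x ∈ s, ‖F m x - F k x‖ < ε) :
    UniformCauchySeqOn F Filter.atTop s := by
  rw [Metric.uniformCauchySeqOn_iff]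
  simpa only [dist_eq_norm] using h

section Limit

variable {K E : Type} [NormedAddCommGroup K] [NormedSpace ℝ K] [NormedAddCommGroup E]
  [NormedSpace ℝ E]

theorem rhoDist_le {V : Set E} {f g : E → K} {ε : NNReal} (h₀ : ∀ z ∈ V, ‖f z - g z‖ ≤ ε / 2)
    (h₁ : ∀ z ∈ V, ‖fderiv ℝ f z - fderiv ℝ g z‖ ≤ ε / 2) : rhoDist V f g ≤ ε := by
  have hε : (ε : ENNReal) = ((ε / 2 : NNReal) : ENNReal) + ((ε / 2 : NNReal) : ENNReal) := by
    rw [← ENNReal.coe_add, add_halves]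
  refine iSup₂_le fun z hz => ?_
  rw [hε]
  refine add_le_add ?_ (iSup₂_le fun w hw => ?_)
  · rw [enorm_le_coe, ← NNReal.coe_le_coe]
    simpa using h₀ z hz
  · rw [enorm_le_coe, ← NNReal.coe_le_coe]
    have h2 := (fderiv ℝ f z - fderiv ℝ g z).le_of_opNorm_le (h₁ z hz) w
    rw [hw, mul_one] at h2
    simpa using h2

/-- Uniform convergence of functions and of their derivatives on an open neighbourhood of `V`
implies convergence in the `C¹` metric on `V`. -/
theorem rhoTendstoFinite_of_uniformCauchySeqOn [CompleteSpace K] {n : ℕ}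
    {V W : Set (KSpace K n)} {f : ℕ → KSpace K n → K} {g : KSpace K n → K} (hW : IsOpen W)
    (hVW : V ⊆ W) (hf : ∀ k, ContDiffOn ℝ 1 (f k) W)
    (hg : TendstoUniformlyOn f g Filter.atTop W)
    (hf' : UniformCauchySeqOn (fun k => fderiv ℝ (f k)) Filter.atTop W) :
    RhoTendstoFinite V f := by
  have hlim : ∀ x : KSpace K n, ∃ T : KSpace K n →L[ℝ] K,
      x ∈ W → Filter.Tendsto (fun k => fderiv ℝ (f k) x) Filter.atTop (nhds T) := by
    intro x
    by_cases hx : x ∈ W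
    · obtain ⟨T, hT⟩ := cauchySeq_tendsto_of_complete (hf'.cauchySeq hx)
      exact ⟨T, fun _ => hT⟩
    · exact ⟨0, fun h => absurd h hx⟩
  choose G hG using hlim
  have hunif := hf'.tendstoUniformlyOn_of_tendsto fun x hx => hG x hx
  have hderiv : ∀ x ∈ W, HasFDerivAt g (G x) x := fun x hx =>
    hasFDerivAt_of_tendstoUniformlyOn hW hunif
      (fun k y hy => (((hf k).contDiffAt (hW.mem_nhds hy)).differentiableAt
        (by simp)).hasFDerivAt)
      (fun y hy => hg.tendsto_at hy) hx
  have hGc : ContinuousOn G W := hunif.continuousOn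
    (Filter.Frequently.of_forall fun k => (hf k).continuousOn_fderiv_of_isOpen hW (by simp))
  refine ⟨g, W, hW, hVW, ?_, ?_⟩
  · rw [show (1 : WithTop ℕ∞) = 0 + 1 from rfl, contDiffOn_succ_iff_fderiv_of_isOpen hW]
    refine ⟨fun x hx => (hderiv x hx).differentiableAt.differentiableWithinAt, by simp, ?_⟩
    rw [contDiffOn_zero]
    exact hGc.congr fun x hx => (hderiv x hx).fderiv
  · rw [ENNReal.tendsto_nhds_zero]
    intro ε hε
    obtain ⟨ε', hε', hlt⟩ := ENNReal.lt_iff_exists_nnreal_btwn.1 hε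
    have hpos : (0 : ℝ) < ε' / 2 := by
      have : (0 : ℝ) < ε' := NNReal.coe_pos.2 (ENNReal.coe_pos.1 hε')
      linarith
    filter_upwards [Metric.tendstoUniformlyOn_iff.1 hg _ hpos,
      Metric.tendstoUniformlyOn_iff.1 hunif _ hpos] with k h1 h2
    refine (rhoDist_le (ε := ε') (fun z hz => ?_) fun z hz => ?_).trans hlt.le
    · rw [norm_sub_rev, ← dist_eq_norm]
      exact (h1 z (hVW hz)).le
    · rw [(hderiv z (hVW hz)).fderiv, norm_sub_rev, ← dist_eq_norm]
      exact (h2 z (hVW hz)).le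

end Limit

/-- A bounded sequence of separately conformal functions has a `C¹`-convergent subsequence on each
compact set: it is locally equi-Lipschitz, and interpolation turns the uniform convergence given by
the Arzelà–Ascoli theorem into uniform convergence of the derivatives. -/
theorem exists_subseq_rhoTendstoFinite {K : Type} [NormedAddCommGroup K] [InnerProductSpace ℝ K]
    [FiniteDimensional ℝ K] (hd : 3 ≤ Module.finrank ℝ K) {n : ℕ} {U V : Set (KSpace K n)}
    (hU : IsOpen U) (hV : IsCompact V) (hVU : V ⊆ U) {f : ℕ → KSpace K n → K} {c : ℝ}
    (hf : ∀ m, IsSeparatelyConformalOn (f m) U) (hbound : ∀ m, ∀ z ∈ U, ‖f m z‖ ≤ c) :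
    ∃ φ : ℕ → ℕ, StrictMono φ ∧ RhoTendstoFinite V (fun k => f (φ k)) := by
  have : ProperSpace K := FiniteDimensional.proper ℝ K
  have : FiniteDimensional ℝ (KSpace K n) :=
    (WithLp.linearEquiv 2 ℝ (Fin n → K)).symm.finiteDimensional
  have : ProperSpace (KSpace K n) := FiniteDimensional.proper ℝ _
  obtain ⟨C, hC, hVC, hCU⟩ := exists_compact_between hV hU hVU
  obtain ⟨φ, hφ, g, hg⟩ := exists_subseq_tendstoUniformlyOn hC f
    (fun m => (hf m).contDiffOn.continuousOn.mono hCU) (fun m z hz => hbound m z (hCU hz))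
    (by
      intro x hx ε hε
      obtain ⟨R, hR, hRU⟩ := Metric.isOpen_iff.1 hU x (hCU hx)
      have hc : 0 ≤ c := (norm_nonneg _).trans (hbound 0 x (hCU hx))
      set L : ℝ := n * (128 * c / (R / 2)) with hL
      have hL0 : 0 ≤ L := by positivity
      refine ⟨min (R / 2) (ε / (L + 1)), by positivity, fun y _ hy m => ?_⟩
      have h1 := (hf m).norm_sub_le hd hR hRU (hbound m) (z := y)
        (hy.trans_le (min_le_left _ _))
      have h2 := hy.trans_le (min_le_right _ _)
      rw [lt_div_iff₀ (by positivity)] at h2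
      rw [dist_comm, dist_eq_norm]
      rw [dist_eq_norm] at h2
      have := norm_nonneg (y - x)
      calc _ ≤ L * ‖y - x‖ := h1
        _ ≤ ‖y - x‖ * (L + 1) := by linarith
        _ < ε := h2)
  obtain ⟨δ, hδ, hδC⟩ := hV.exists_cthickening_subset_open isOpen_interior hVC
  have hball : ∀ x ∈ Metric.thickening (δ / 2) V, Metric.ball x (δ / 2) ⊆ C := by
    intro x hx y hy
    obtain ⟨v, hv, hxv⟩ := Metric.mem_thickening_iff.1 hx
    refine interior_subset (hδC (Metric.thickening_subset_cthickening δ V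
      (Metric.mem_thickening_iff.2 ⟨v, hv, ?_⟩)))
    linarith [dist_triangle y x v, Metric.mem_ball.1 hy]
  have hWC : Metric.thickening (δ / 2) V ⊆ C := fun x hx =>
    hball x hx (Metric.mem_ball_self (half_pos hδ))
  refine ⟨φ, hφ, rhoTendstoFinite_of_uniformCauchySeqOn Metric.isOpen_thickening
    (Metric.self_subset_thickening (half_pos hδ) V)
    (fun k => ((hf _).contDiffOn.mono (hWC.trans hCU)).of_le (by simp)) (hg.mono hWC) ?_⟩
  suffices h : ∀ ε > 0, ∃ N : ℕ, ∀ m ≥ N, ∀ k ≥ N, ∀ x ∈ Metric.thickening (δ / 2) V,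
      ‖fderiv ℝ (f (φ m)) x - fderiv ℝ (f (φ k)) x‖ < ε from
    uniformCauchySeqOn_of_norm (F := fun k => fderiv ℝ (f (φ k))) h
  intro ε hε
  rcases V.eq_empty_or_nonempty with rfl | ⟨v, hv⟩
  · simp
  have hc : 0 ≤ c := (norm_nonneg _).trans (hbound 0 v (hVU hv))
  set M : ℝ := n * (2 + 4096 * c / (δ / 2) ^ 2) with hM
  have hM0 : 0 ≤ M := by positivity
  set s : ℝ := min (δ / 2 / 4) (ε / (M + 1)) with hs
  have hs0 : 0 < s := by positivity
  have hsM : M * s < ε := by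
    have h1 : s * (M + 1) ≤ ε := by
      rw [← le_div_iff₀ (by positivity)]
      exact min_le_right _ _
    linarith
  obtain ⟨N, hN⟩ := Metric.uniformCauchySeqOn_iff.1 hg.uniformCauchySeqOn (s ^ 2) (by positivity)
  refine ⟨N, fun m hm k hk x hx => ?_⟩
  have h1 := IsSeparatelyConformalOn.norm_fderiv_sub_fderiv_le hd (hf (φ m)) (hf (φ k))
    (half_pos hδ) ((hball x hx).trans hCU) (hbound _) (hbound _) hs0 (min_le_left _ _)
    (fun z hz => by
      rw [← dist_eq_norm]
      exact (hN m hm k hk z (hball x hx hz)).le)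
  calc _ ≤ M * s := by rw [hM, mul_assoc]; exact h1
    _ < ε := hsM

/-! ### Normality over the quaternions and the octonions -/

section Normality

variable {K : Type} [Mul K] [NormedAddCommGroup K] [InnerProductSpace ℝ K]

theorem KHolomorphicOn.contDiffOn [FiniteDimensional ℝ K] {n : ℕ} {f : KSpace K n → K}
    {U : Set (KSpace K n)} (hf : KHolomorphicOn f U) : ContDiffOn ℝ ∞ f U := by
  have : CompleteSpace K := FiniteDimensional.complete ℝ K
  intro ξ hξ
  obtain ⟨p, hp, -⟩ := hf ξ hξ
  exact hp.analyticAt.contDiffAt.contDiffWithinAt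

variable [Star K]

theorem PseudoconformalAt.inner_eq_zero {o : K} (ho : o ≠ 0)
    (hre : ∀ z w : K, kRe (z * star w) = ⟪z, w⟫ • o) {g : K → K} {ξ : K}
    (hg : PseudoconformalAt g ξ) {u v : K} (huv : ⟪u, v⟫ = 0) :
    ⟪fderiv ℝ g ξ u, fderiv ℝ g ξ v⟫ = 0 := by
  have h := hg.2.1 u v
  rw [hre, hre, huv, zero_smul, smul_zero, smul_smul] at h
  rcases eq_or_ne u 0 with rfl | hu
  · rw [map_zero, inner_zero_left]
  rcases eq_or_ne v 0 with rfl | hv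
  · rw [map_zero, inner_zero_right]
  exact (mul_eq_zero.1 ((smul_eq_zero.1 h).resolve_right ho)).resolve_left
    (mul_ne_zero (norm_ne_zero_iff.2 hu) (norm_ne_zero_iff.2 hv))

theorem isNormalFamily_of_norm_le [FiniteDimensional ℝ K] (hd : 3 ≤ Module.finrank ℝ K) {o : K}
    (ho : o ≠ 0) (hre : ∀ z w : K, kRe (z * star w) = ⟪z, w⟫ • o) {n : ℕ}
    {U : Set (KSpace K n)} {F : Set (KSpace K n → K)} (hU : IsOpen U)
    (hF : ∀ f ∈ F, KHolomorphicOn f U ∧ PseudoconformalOrZeroOn f U) {c : ℝ}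
    (hc : ∀ f ∈ F, ∀ z ∈ U, ‖f z‖ ≤ c) : IsNormalFamily U F := by
  refine ⟨hF, fun f hf V hVU hVb _ hVc => ?_⟩
  have : FiniteDimensional ℝ (KSpace K n) :=
    (WithLp.linearEquiv 2 ℝ (Fin n → K)).symm.finiteDimensional
  have : ProperSpace (KSpace K n) := FiniteDimensional.proper ℝ _
  have hsep : ∀ m, IsSeparatelyConformalOn (f m) U := fun m =>
    ⟨(hF _ (hf m)).1.contDiffOn, fun ξ hξ j u v huv => by
      rcases (hF _ (hf m)).2 ξ hξ j with h | h
      · exact h.inner_eq_zero ho hre huv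
      · simp [h]⟩
  obtain ⟨φ, hφ, h⟩ := exists_subseq_rhoTendstoFinite hd hU
    (Metric.isCompact_of_isClosed_isBounded hVc hVb) hVU hsep fun m => hc _ (hf m)
  exact ⟨φ, hφ, Or.inl h⟩

end Normality

theorem Quaternion.half_smul_add_star (q : Quaternion ℝ) :
    (1 / 2 : ℝ) • (q + star q) = q.re • (1 : Quaternion ℝ) := by
  ext <;> simp
  ring

theorem Quaternion.kRe_mul_star (z w : Quaternion ℝ) :
    kRe (z * star w) = ⟪z, w⟫ • (1 : Quaternion ℝ) := by
  rw [kRe, Quaternion.inner_def]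
  exact Quaternion.half_smul_add_star (z * star w)

namespace Octonion

theorem inner_eq (z w : Octonion) : ⟪z, w⟫ = ⟪z.fst, w.fst⟫ + ⟪z.snd, w.snd⟫ :=
  WithLp.prod_inner_apply (𝕜 := ℝ) (E := Quaternion ℝ) (F := Quaternion ℝ) z w

/-- The first component of `z w̃` is `z₁ w̃₁ + w̃₂ z₂`, whose real part is the inner product, and the
second component of `u + ũ` vanishes. -/
theorem kRe_mul_star (z w : Octonion) : kRe (z * star w) = ⟪z, w⟫ • mk 1 0 := by
  have h1 : (z * star w).fst = z.fst * star w.fst + star w.snd * z.snd := by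
    change z.fst * star w.fst - star (-w.snd) * z.snd = _
    rw [star_neg, neg_mul, sub_neg_eq_add]
  change mk ((1 / 2 : ℝ) • ((z * star w).fst + star (z * star w).fst))
      ((1 / 2 : ℝ) • ((z * star w).snd + -(z * star w).snd)) =
    mk (⟪z, w⟫ • (1 : Quaternion ℝ)) (⟪z, w⟫ • (0 : Quaternion ℝ))
  congr 1
  · have h2 : (star w.snd * z.snd).re = ⟪z.snd, w.snd⟫ := by
      rw [Quaternion.inner_def]
      simp
      ring
    rw [Quaternion.half_smul_add_star, h1, Quaternion.re_add, h2, ← Quaternion.inner_def,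
      ← inner_eq]
  · simp

theorem finrank_eq_eight : Module.finrank ℝ Octonion = 8 := by
  have h : Module.finrank ℝ Octonion = Module.finrank ℝ (Quaternion ℝ × Quaternion ℝ) :=
    (WithLp.linearEquiv 2 ℝ (Quaternion ℝ × Quaternion ℝ)).finrank_eq
  rw [h, Module.finrank_prod, Quaternion.finrank_eq_four]

theorem mk_one_zero_ne_zero : mk 1 0 ≠ 0 := fun h => one_ne_zero (congrArg fst h)

end Octonion

theorem mainTheorem5 (n : ℕ) (hn : 1 ≤ n) :
    (∀ (U : Set (KSpace (Quaternion ℝ) n)) (F : Set (KSpace (Quaternion ℝ) n → Quaternion ℝ)),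
      IsOpen U → ProjectionConditions quaternionGen U →
      (∀ f ∈ F, KHolomorphicOn f U ∧ PseudoconformalOrZeroOn f U) →
      (∃ c : ℝ, ∀ f ∈ F, ∀ z ∈ U, ‖f z‖ ≤ c) →
      IsNormalFamily U F) ∧
    (∀ (U : Set (KSpace Octonion n)) (F : Set (KSpace Octonion n → Octonion)),
      IsOpen U → ProjectionConditions octonionGen U →
      (∀ f ∈ F, KHolomorphicOn f U ∧ PseudoconformalOrZeroOn f U) →
      (∃ c : ℝ, ∀ f ∈ F, ∀ z ∈ U, ‖f z‖ ≤ c) →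
      IsNormalFamily U F) := by
  refine ⟨fun U F hU _ hF ⟨c, hc⟩ => ?_, fun U F hU _ hF ⟨c, hc⟩ => ?_⟩
  · have hd : 3 ≤ Module.finrank ℝ (Quaternion ℝ) := by
      rw [Quaternion.finrank_eq_four]
      norm_num
    exact isNormalFamily_of_norm_le hd one_ne_zero Quaternion.kRe_mul_star hU hF hc
  · have hd : 3 ≤ Module.finrank ℝ Octonion := by
      rw [Octonion.finrank_eq_eight]
      norm_num
    exact isNormalFamily_of_norm_le hd Octonion.mk_one_zero_ne_zero Octonion.kRe_mul_star hU hF hc
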